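/- **Setting.** Let $\mathcal A\subset\mathbb R^d$ be a finite set of policy parameters, $\mathcal X\subset\mathbb R^\ell$ a bounded state space, $\mu>0$, and $\mathcal X_\mu\subseteq\mathcal X$ a finite set such that, writing $[x]_\mu$ for an element of $\mathcal X_\mu$ of smallest $L_1$-distance to $x\in\mathcal X$, one has $\|x-[x]_\mu\|\le\mu$ for all $x\in\mathcal X$. The dynamics $\mathrm dx=z(x,u)\,\mathrm dt$ are Lipschitz, $u=\pi(x;a)$ is a parameterized policy, and for every $a\in\mathcal A$ and initial state $x\in\mathcal X$ there is a unique trajectory $\xi_{a,x}:[0,\infty)\to\mathcal X$, $\xi_{a,x}(t)=x+\int_0^t z(\xi_{a,x},\pi(\xi_{a,x};a))\,\mathrm d\tau$. Let $f:\mathcal A\times\mathcal X\to\mathbb R$ be the reward, $\bar g_i:\mathcal X\to\mathbb R$ $(i\in\mathcal I_g=\{1,\dots,q\})$ the immediate constraints, and $g_i(a,x)=\inf_{t\ge0}\bar g_i(\xi_{a,x}(t))$, assumed finite. Put $h(\cdot,0)=f$, $h(\cdot,i)=g_i$, $\mathcal I=\{0,\dots,q\}$. Assume $|h(a,x,i)-h(a',x',i)|\le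 L_a\|a-a'\|+L_x\|x-x'\|$ with $L_a,L_x\ge0$. Let $\epsilon>0$, let $x_0\in\mathcal X_\mu$ be the nominal initial condition, and let $S_0\subseteq\mathcal A\times\mathcal X_\mu$ contain some $(a,x_0)$ and satisfy $g_i(a,x)>L_x\mu$ for all $(a,x)\in S_0$, $i\in\mathcal I_g$. **Reachable set.** For $S\subseteq\mathcal A\times\mathcal X_\mu$ call $x\in\mathcal X_\mu$ *covered* by $S$ if $(a,x)\in S$ for some $a$, and let $\partial S$ be the set of covered $x\in\mathcal X_\mu$ for which there is $y\in\mathcal X$ with $\|x-y\|<2\mu$ and $[y]_\mu$ not covered. With $\kappa(p',p)=L_a\|a'-a\|+L_x(\|x'-x\|+\mu)$ for $p=(a,x)$, $p'=(a',x')$, let $$R^c_\epsilon(S)=S\cup\{p:\exists p'\in S\ \forall i\in\mathcal I_g:\ g_i(p')-\epsilon-\kappa(p',p)\ge0\},$$ $$R_\epsilon(S)=R^c_\epsilon(S)\cup\{(a,x): x\text{ is covered by }S\text{ and }[\xi_{a,x}(t)]_\mu\notin\partial R^c_\epsilon(S)\ \forall t\ge0\},$$ and $\bar R_\epsilon(S_0)=\bigcup_{n}R^n_\epsilon(S_0)$.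 **Algorithm (GoSafe).** Let $h$ belong to a reproducing kernel Hilbert space of functions on $\mathcal A\times\mathcal X\times\mathcal I$ with kernel $k$, with norm at most $B$. A measurement at $p=(a,x)$ returns $h(p,i)+v_i$ for all $i\in\mathcal I$; the noise is conditionally $\sigma$-sub-Gaussian: for the noise vector $v$ of each iteration, the history $\mathcal F$ before the measurement, and all $c\in\mathbb R^{q+1}$, $\mathbb E[e^{\langle c,v\rangle}\mid\mathcal F]\le e^{\sigma^2\|c\|^2/2}$, where $\sigma\ge0$ (for instance, independent $\sigma$-sub-Gaussian noise). Let $\mu_{n-1},\sigma_{n-1}$ be the posterior mean and standard deviation, before iteration $n$, of the zero-mean Gaussian process model with kernel $k$ and model noise variance $\rho\ge\tfrac18$, i.e. $k_D(K_D+\rho I)^{-1}y$ and $(k(\zeta,\zeta)-k_D(K_D+\rho I)^{-1}k_D^{T})^{1/2}$. Let $\gamma_N$ be the maximum of $\tfrac12\log\det(I+\rho^{-1}K)$ over the covariance matrices $K$ of $N$ points of $\mathcal A\times\mathcal X_\mu\times\mathcal I$ (with repetition), let $\delta\in(0,1)$ and $\beta_n^{1/2}=B+4\sigma\sqrt{\gamma_{(n-1)|\mathcal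 I|}+1+\ln(1/\delta)}$. Put $C_0(p,i)=[L_x\mu,\infty)$ for $p\in S_0$, $i\in\mathcal I_g$, and $C_0(p,i)=\mathbb R$ otherwise; the set of interrupted experiments $\mathcal E$ is empty at first. Iteration $n=1,2,\dots$ is as follows. 1. Let $C_n=C_{n-1}\cap[\mu_{n-1}\pm\beta_n^{1/2}\sigma_{n-1}]$, $l_n=\min C_n$, $u_n=\max C_n$, $w_n=u_n-l_n$, and $S_n=S_{n-1}\cup\bigcap_{i\in\mathcal I_g}\bigcup_{p\in S_{n-1}}\{p':l_n(p,i)-\kappa(p,p')\ge0\}$. Let $G_n$ be the set of $p\in S_n$ such that $u_n(p,i)-\kappa(p,p')\ge0$ for some $p'\notin S_n$ and $i\in\mathcal I_g$, and $M_n$ the set of $(a,x_0)\in S_n$ with $u_n(a,x_0,0)\ge l_n(a',x_0,0)$ for all $(a',x_0)\in S_n$. 2. (S1) If $w_n(a,x_0,i)>\epsilon$ for some $(a,x_0)\in G_n\cup M_n$, $i\in\mathcal I$, measure at a maximizer of $\max_{i\in\mathcal I}w_n(a,x_0,i)$ over such $(a,x_0)$. (S2) Otherwise, if $w_n(p,i)>\epsilon$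 for some $p\in G_n$, $i\in\mathcal I_g$, measure at a maximizer of $\max_{i\in\mathcal I_g}w_n(p,i)$ over $G_n$. (S3) Otherwise, choose a maximizer $(a,x)$ of $\max_{i\in\mathcal I}w_n$ over the pairs $(a,x)\notin S_n\cup\mathcal E$ with $x$ covered by $S_n$, if there are any. If its quantized trajectory never hits $\partial S_n$, measure and add $(a,x)$ to $S_n$; otherwise interrupt when the quantized trajectory is at some $r\in\partial S_n$ (switching to a backup policy), take no measurement, and add $(a,x)$ with record $r$ to $\mathcal E$. 3. Delete from $\mathcal E$ the experiments whose record is no longer in $\partial S_n$. The best guess is $\hat a_n\in\arg\max_{(a,x_0)\in S_n}l_n(a,x_0,0)$. Ties are broken arbitrarily, without knowledge of the noise of the measurement about to be taken. **Corollary.** Let $a^*$ maximize $f(a,x_0)$ over all $a\in\mathcal A$ with $g_i(a,x_0)\ge0$ for all $i\in\mathcal I_g$. If $[\xi_{a^*,x_0}(t)]_\mu\notin\partial\bar R_\epsilon(S_0)$ for all $t\ge0$, then $(a^*,x_0)\in\bar R_\epsilon(S_0)$, and GoSafe finds an $\epsilon$-optimal solution of the constrained problem: with probability at least $1-\delta$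 there is an $N$ such that, for all $n\ge N$, $$g_i(\hat a_n,x_0)\ge0\ \ \forall i\in\mathcal I_g\qquad\text{and}\qquad f(\hat a_n,x_0)\ge f(a^*,x_0)-\epsilon .$$ -/

import Mathlib

open MeasureTheory Set

namespace GoSafe

noncomputable section

/-- The data of a safe policy search problem: a finite set `A ⊆ ℝ^d` of policy parameters, a state
space `X ⊆ ℝ^ℓ` with its finite quantized version `grid` and the quantization map `quant`, the
dynamics `z`, the policy, the trajectories, the reward `f`, the immediate constraints `gbar`, the
nominal initial condition `x0`, the safe seed `S0`, and the constants. -/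
structure Problem (d ℓ m q : ℕ) where
  A : Finset (EuclideanSpace ℝ (Fin d))
  X : Set (EuclideanSpace ℝ (Fin ℓ))
  grid : Finset X
  quant : X → grid
  μ : ℝ
  z : X → EuclideanSpace ℝ (Fin m) → EuclideanSpace ℝ (Fin ℓ)
  policy : A → X → EuclideanSpace ℝ (Fin m)
  /-- `traj a x t` is the state at time `t ≥ 0` under parameters `a` from the initial state `x`;
  values at negative times are irrelevant. -/
  traj : A → X → ℝ → X
  f : A → X → ℝ
  gbar : Fin q → X → ℝ
  x0 : grid
  S0 : Set (A × grid)
  La : ℝ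
  Lx : ℝ
  ε : ℝ

namespace Problem

variable {d ℓ m q : ℕ} (P : Problem d ℓ m q)

/-- Pairs of policy parameters and quantized initial conditions. -/
abbrev Point : Type := P.A × P.grid

/-- The domain of the surrogate selector function, on which the kernel lives. -/
abbrev Dom : Type := P.A × P.X × Fin (q + 1)

/-- `y` solves `dx = z(x, π(x; a)) dt` with `x(0) = x` on `[0, ∞)`, inside `X`. -/
def IsTrajectory (a : P.A) (x : P.X) (y : ℝ → P.X) : Prop :=
  ∀ t : ℝ, 0 ≤ t →
    IntervalIntegrable (fun τ => P.z (y τ) (P.policy a (y τ))) volume 0 t ∧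
    (y t : EuclideanSpace ℝ (Fin ℓ)) = x + ∫ τ in (0 : ℝ)..t, P.z (y τ) (P.policy a (y τ))

/-- The constraint function: the smallest value of `gbar i` along the trajectory. -/
def g (i : Fin q) (a : P.A) (x : P.X) : ℝ :=
  sInf ((fun t => P.gbar i (P.traj a x t)) '' Ici (0 : ℝ))

/-- The surrogate selector function: index `0` is the reward, index `i + 1` the `i`-th
constraint. -/
def h (a : P.A) (x : P.X) (i : Fin (q + 1)) : ℝ :=
  Fin.cases (P.f a x) (fun j => P.g j a x) i

/-- Distance of parameters. -/
def da (a a' : P.A) : ℝ := ‖(a : EuclideanSpace ℝ (Fin d)) - a'‖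

/-- Distance of states. -/
def dx (x x' : P.X) : ℝ := ‖(x : EuclideanSpace ℝ (Fin ℓ)) - x'‖

/-- `L_1`-distance of states. -/
def dOne (x x' : P.X) : ℝ :=
  ∑ j, |(x : EuclideanSpace ℝ (Fin ℓ)) j - (x' : EuclideanSpace ℝ (Fin ℓ)) j|

/-- The standing assumptions. -/
structure Standing : Prop where
  bounded : Bornology.IsBounded P.X
  μ_pos : 0 < P.μ
  ε_pos : 0 < P.ε
  La_nonneg : 0 ≤ P.La
  Lx_nonneg : 0 ≤ P.Lx
  /-- `[x]_μ` is a grid point of smallest `L_1`-distance to `x`. -/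
  quant_nearest : ∀ (x : P.X) (y : P.grid), P.dOne x (P.quant x) ≤ P.dOne x y
  quant_close : ∀ x : P.X, P.dx x (P.quant x) ≤ P.μ
  z_lipschitz : ∃ K : NNReal,
    LipschitzWith K (fun p : P.X × EuclideanSpace ℝ (Fin m) => P.z p.1 p.2)
  traj_spec : ∀ (a : P.A) (x : P.X), P.IsTrajectory a x (P.traj a x)
  traj_unique : ∀ (a : P.A) (x : P.X) (y : ℝ → P.X), P.IsTrajectory a x y →
    ∀ t : ℝ, 0 ≤ t → y t = P.traj a x t
  /-- The smallest value of a constraint along a trajectory is a real number. -/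
  gbar_bddBelow : ∀ (i : Fin q) (a : P.A) (x : P.X),
    BddBelow ((fun t => P.gbar i (P.traj a x t)) '' Ici (0 : ℝ))
  f_lipschitz : ∀ (a a' : P.A) (x x' : P.X),
    |P.f a x - P.f a' x'| ≤ P.La * P.da a a' + P.Lx * P.dx x x'
  g_lipschitz : ∀ (i : Fin q) (a a' : P.A) (x x' : P.X),
    |P.g i a x - P.g i a' x'| ≤ P.La * P.da a a' + P.Lx * P.dx x x'
  /-- The seed contains safe parameters for the nominal initial condition. -/
  seed_nominal : ∃ a : P.A, (a, P.x0) ∈ P.S0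
  seed_safe : ∀ p ∈ P.S0, ∀ i : Fin q, P.Lx * P.μ < P.g i p.1 p.2

/-- `a` satisfies all constraints from the nominal initial condition. -/
def Feasible (a : P.A) : Prop := ∀ i : Fin q, 0 ≤ P.g i a P.x0

/-- `a` solves the constrained problem for the nominal initial condition. -/
def IsConstrainedMax (a : P.A) : Prop :=
  P.Feasible a ∧ ∀ a' : P.A, P.Feasible a' → P.f a' P.x0 ≤ P.f a P.x0

/-- Some parameters are in `S` together with the quantized state `x`. -/
def Covered (S : Set P.Point) (x : P.grid) : Prop := ∃ a : P.A, (a, x) ∈ S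

/-- The border `∂S`: covered grid states with a state nearby whose quantization is not covered. -/
def border (S : Set P.Point) : Set P.grid :=
  {x | P.Covered S x ∧ ∃ y : P.X, P.dx x y < 2 * P.μ ∧ ¬ P.Covered S (P.quant y)}

/-- The quantized trajectory from `p` never hits `D`. -/
def Avoids (p : P.Point) (D : Set P.grid) : Prop :=
  ∀ t : ℝ, 0 ≤ t → P.quant (P.traj p.1 p.2 t) ∉ D

/-- The safety margin lost between `p` and `p'`. -/
def slack (p p' : P.Point) : ℝ := P.La * P.da p.1 p'.1 + P.Lx * (P.dx p.2 p'.2 + P.μ)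

/-- The one-step reachability operator `R_ε^c`. -/
def Rcon (S : Set P.Point) : Set P.Point :=
  S ∪ {p | ∃ p' ∈ S, ∀ i : Fin q, 0 ≤ P.g i p'.1 p'.2 - P.ε - P.slack p' p}

/-- The global reachability operator `R_ε`. -/
def Rglob (S : Set P.Point) : Set P.Point :=
  P.Rcon S ∪ {p | P.Covered S p.2 ∧ P.Avoids p (P.border (P.Rcon S))}

/-- The closure `R̄_ε(S_0)`: the limit of the increasing sequence of iterates of `R_ε`. -/
def Rbar : Set P.Point := ⋃ n : ℕ, P.Rglob^[n] P.S0

/-! ### The algorithm -/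

/-- A safely explored point with the measurements of reward and constraints taken there. -/
abbrev Datum : Type := P.Point × (Fin (q + 1) → ℝ)

/-- Inclusion of the quantized domain into the domain of the kernel. -/
def toDom (p : P.Point) (i : Fin (q + 1)) : P.Dom := (p.1, (p.2 : P.X), i)

end Problem

/-- The parameters of the Gaussian process model and its confidence bounds: the (prior) covariance
kernel `k`, the model's noise variance `ρ`, the bound `B` on the RKHS norm, the sub-Gaussian
constant `σ` of the noise, and the failure probability `δ`. -/
structure Model {d ℓ m q : ℕ} (P : Problem d ℓ m q) where
  k : P.Dom → P.Dom → ℝ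
  ρ : ℝ
  B : ℝ
  σ : ℝ
  δ : ℝ

/-- What the algorithm remembers after an iteration: measurements, contained sets `C_n`, safe set
`S_n`, and interrupted experiments, each with the quantized state at which it was interrupted. -/
structure Memory {d ℓ m q : ℕ} (P : Problem d ℓ m q) where
  data : List P.Datum
  C : P.Point → Fin (q + 1) → Set ℝ
  S : Set P.Point
  F : Set (P.Point × P.grid)

/-- The experiment of one iteration: completed at `p`, or interrupted with the quantized state
being `r`; `idle` if there is nothing left to evaluate. -/
inductive Move {d ℓ m q : ℕ} (P : Problem d ℓ m q) where
  | idle : Move P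
  | done (p : P.Point) : Move P
  | stopped (p : P.Point) (r : P.grid) : Move P

namespace Model

variable {d ℓ m q : ℕ} {P : Problem d ℓ m q} (M : Model P)

/-- Covariance matrix at the points `u`. -/
def gram {ι : Type*} (u : ι → P.Dom) : Matrix ι ι ℝ := Matrix.of fun i j => M.k (u i) (u j)

/-- The locations of the measurements in `D`. -/
def loc (D : List P.Datum) (j : Fin D.length × Fin (q + 1)) : P.Dom :=
  P.toDom (D.get j.1).1 j.2

/-- The measured values in `D`. -/
def obs (D : List P.Datum) (j : Fin D.length × Fin (q + 1)) : ℝ := (D.get j.1).2 j.2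

/-- Posterior mean `k_D(z) (K_D + ρ I)⁻¹ y`. -/
def mean (D : List P.Datum) (z : P.Dom) : ℝ :=
  (fun j => M.k z (loc D j)) ⬝ᵥ (M.gram (loc D) + M.ρ • 1)⁻¹.mulVec (obs D)

/-- Posterior variance `k(z, z) - k_D(z) (K_D + ρ I)⁻¹ k_D(z)ᵀ`. -/
def var (D : List P.Datum) (z : P.Dom) : ℝ :=
  M.k z z - (fun j => M.k z (loc D j)) ⬝ᵥ
    (M.gram (loc D) + M.ρ • 1)⁻¹.mulVec (fun j => M.k z (loc D j))

/-- Posterior standard deviation. -/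
def sd (D : List P.Datum) (z : P.Dom) : ℝ := √(M.var D z)

/-- Information capacity: the largest mutual information between the function and `N` noisy
measurements at points of the quantized domain. -/
def gamma (N : ℕ) : ℝ :=
  ⨆ u : Fin N → P.Point × Fin (q + 1),
    (1 / 2) * Real.log
      (1 + M.ρ⁻¹ • M.gram (fun j => P.toDom (u j).1 (u j).2)).det

/-- `β_n^{1/2}`. -/
def sqrtBeta (n : ℕ) : ℝ :=
  M.B + 4 * M.σ * √(M.gamma ((n - 1) * (q + 1)) + 1 + Real.log (1 / M.δ))

/-- The confidence interval `Q_n`. -/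
def Q (n : ℕ) (D : List P.Datum) (p : P.Point) (i : Fin (q + 1)) : Set ℝ :=
  Icc (M.mean D (P.toDom p i) - M.sqrtBeta n * M.sd D (P.toDom p i))
    (M.mean D (P.toDom p i) + M.sqrtBeta n * M.sd D (P.toDom p i))

end Model

section Sets

variable {d ℓ m q : ℕ} {P : Problem d ℓ m q}

/-- Lower confidence bound. -/
def lo (C : P.Point → Fin (q + 1) → Set ℝ) (p : P.Point) (i : Fin (q + 1)) : ℝ := sInf (C p i)

/-- Upper confidence bound. -/
def up (C : P.Point → Fin (q + 1) → Set ℝ) (p : P.Point) (i : Fin (q + 1)) : ℝ := sSup (C p i)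

/-- Width of the confidence interval. -/
def width (C : P.Point → Fin (q + 1) → Set ℝ) (p : P.Point) (i : Fin (q + 1)) : ℝ :=
  up C p i - lo C p i

/-- The safe set update. -/
def expand (C : P.Point → Fin (q + 1) → Set ℝ) (S : Set P.Point) : Set P.Point :=
  (⋂ i : Fin q, ⋃ p ∈ S, {p' | 0 ≤ lo C p i.succ - P.slack p p'}) ∪ S

/-- Potential maximizers. -/
def maximizers (C : P.Point → Fin (q + 1) → Set ℝ) (S : Set P.Point) : Set P.Point :=
  {p | p ∈ S ∧ p.2 = P.x0 ∧ ∀ a' : P.A, (a', P.x0) ∈ S → lo C (a', P.x0) 0 ≤ up C p 0}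

/-- Potential expanders: optimistically, at least one point outside `S` satisfies at least one
constraint. -/
def expanders (C : P.Point → Fin (q + 1) → Set ℝ) (S : Set P.Point) : Set P.Point :=
  {p | p ∈ S ∧ 0 < {p' | p' ∉ S ∧ ∃ i : Fin q, 0 ≤ up C p i.succ - P.slack p p'}.ncard}

/-- Domain of the acquisition function in the first stage. -/
def stageOne (C : P.Point → Fin (q + 1) → Set ℝ) (S : Set P.Point) : Set P.Point :=
  {p | p ∈ expanders C S ∪ maximizers C S ∧ p.2 = P.x0}

/-- Domain of the acquisition function in the third stage; `F` are the interrupted experiments. -/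
def stageThree (S : Set P.Point) (F : Set (P.Point × P.grid)) : Set P.Point :=
  {p | p ∉ S ∧ (∀ r, (p, r) ∉ F) ∧ P.Covered S p.2}

/-- `p` maximizes `w` over `T`. -/
def IsArgmax (w : P.Point → ℝ) (T : Set P.Point) (p : P.Point) : Prop :=
  p ∈ T ∧ ∀ p' ∈ T, w p' ≤ w p

/-- Under `p`, the experiment may be interrupted at quantized state `r`: the quantized trajectory
is at `r ∈ ∂S` at some time up to which it has not left the states covered by `S`. A backup policy
for `r` exists by definition of `∂S`. -/
def MayStop (S : Set P.Point) (p : P.Point) (r : P.grid) : Prop :=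
  ∃ t : ℝ, 0 ≤ t ∧ P.quant (P.traj p.1 p.2 t) = r ∧ r ∈ P.border S ∧
    ∀ s ∈ Icc (0 : ℝ) t, P.Covered S (P.quant (P.traj p.1 p.2 s))

end Sets

namespace Memory

variable {d ℓ m q : ℕ} {P : Problem d ℓ m q}

open Classical in
/-- Initially there are no data; the seed is known to satisfy the constraints. -/
def init (P : Problem d ℓ m q) : Memory P where
  data := []
  C := fun p i => if p ∈ P.S0 ∧ i ≠ 0 then Ici (P.Lx * P.μ) else univ
  S := P.S0
  F := ∅

variable (M : Model P) (n : ℕ) (s : Memory P)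

/-- The contained sets `C_n = C_{n-1} ∩ Q_n` in iteration `n`. -/
def conf (p : P.Point) (i : Fin (q + 1)) : Set ℝ := s.C p i ∩ M.Q n s.data p i

/-- The safe set in iteration `n`, updated with the bounds of iteration `n`. -/
def safe : Set P.Point := expand (s.conf M n) s.S

/-- Condition of the first stage: some width exceeds `ε` among the expanders and maximizers with
nominal initial condition. -/
def CondOne : Prop :=
  ∃ p ∈ stageOne (s.conf M n) (s.safe M n), ∃ i : Fin (q + 1), P.ε < width (s.conf M n) p i

/-- Condition of the second stage: some constraint width exceeds `ε` among the expanders. -/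
def CondTwo : Prop :=
  ∃ p ∈ expanders (s.conf M n) (s.safe M n), ∃ i : Fin q, P.ε < width (s.conf M n) p i.succ

/-- The experiments that the algorithm may carry out in iteration `n` with memory `s`; ties in an
`argmax` may be broken in any way. -/
def Legal (mv : Move P) : Prop :=
  (s.CondOne M n → ∃ p, mv = .done p ∧
    IsArgmax (fun p => ⨆ i : Fin (q + 1), width (s.conf M n) p i)
      (stageOne (s.conf M n) (s.safe M n)) p) ∧
  (¬ s.CondOne M n → s.CondTwo M n → ∃ p, mv = .done p ∧
    IsArgmax (fun p => ⨆ i : Fin q, width (s.conf M n) p i.succ)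
      (expanders (s.conf M n) (s.safe M n)) p) ∧
  (¬ s.CondOne M n → ¬ s.CondTwo M n →
    (stageThree (s.safe M n) s.F = ∅ ∧ mv = .idle) ∨
    ∃ p, IsArgmax (fun p => ⨆ i : Fin (q + 1), width (s.conf M n) p i)
        (stageThree (s.safe M n) s.F) p ∧
      ((P.Avoids p (P.border (s.safe M n)) ∧ mv = .done p) ∨
        ∃ r, MayStop (s.safe M n) p r ∧ mv = .stopped p r))

/-- The measurements after iteration `n`, with measurement noise `v`. -/
def nextData (v : Fin (q + 1) → ℝ) : Move P → List P.Datum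
  | .done p => s.data ++ [(p, fun i => P.h p.1 p.2 i + v i)]
  | .idle => s.data
  | .stopped _ _ => s.data

/-- The safe set after iteration `n`: a completed experiment is safe. (The points evaluated in the
first two stages already belong to the safe set.) -/
def nextSafe : Move P → Set P.Point
  | .done p => s.safe M n ∪ {p}
  | .idle => s.safe M n
  | .stopped _ _ => s.safe M n

/-- The recorded interruptions, including that of the present experiment. -/
def allFails : Move P → Set (P.Point × P.grid)
  | .stopped p r => s.F ∪ {(p, r)}
  | .idle => s.F
  | .done _ => s.F

/-- The memory after iteration `n`. Interrupted experiments whose recorded state is no longer on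
the border of the safe set are deleted, so that they may be repeated. -/
def next (mv : Move P) (v : Fin (q + 1) → ℝ) : Memory P where
  data := s.nextData v mv
  C := s.conf M n
  S := s.nextSafe M n mv
  F := {e ∈ s.allFails mv | e.2 ∈ P.border (s.nextSafe M n mv)}

/-- `a` is a best guess: it maximizes the lower bound of the reward among the parameters which are
safe for the nominal initial condition. -/
def IsBest (a : P.A) : Prop :=
  (a, P.x0) ∈ s.S ∧ ∀ a' : P.A, (a', P.x0) ∈ s.S → lo s.C (a', P.x0) 0 ≤ lo s.C (a, P.x0) 0

/-- The memory after `n` iterations with given experiments and noise. -/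
def after (move : ℕ → Move P) (noise : ℕ → Fin (q + 1) → ℝ) : ℕ → Memory P
  | 0 => init P
  | n + 1 => (after move noise n).next M (n + 1) (move n) (noise n)

end Memory

/-- The process `v` of measurement noise vectors, `v n` being revealed at time `n + 1`, is
conditionally `σ`-sub-Gaussian with respect to the filtration `ℱ`. This holds in particular if all
`v n i` are independent and `σ`-sub-Gaussian. -/
def SubGaussianNoise {q : ℕ} {Ω : Type*} {mΩ : MeasurableSpace Ω} (ℙ : Measure Ω)
    (ℱ : Filtration ℕ mΩ) (σ : ℝ) (v : ℕ → Ω → Fin (q + 1) → ℝ) : Prop :=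
  (∀ n i, Measurable[ℱ (n + 1)] fun ω => v n ω i) ∧
  ∀ (n : ℕ) (c : Fin (q + 1) → ℝ),
    Integrable (fun ω => Real.exp (∑ i, c i * v n ω i)) ℙ ∧
    ℙ[fun ω => Real.exp (∑ i, c i * v n ω i) | ℱ n] ≤ᵐ[ℙ]
      fun _ => Real.exp (σ ^ 2 * (∑ i, c i ^ 2) / 2)

/-- A run of the algorithm on a probability space: `move n` is the experiment of iteration `n + 1`,
`noise n` its measurement noise, and `guess n` the best guess afterwards. The choice of an
experiment and its interruption do not depend on the noise of its measurement. -/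
structure IsRun {d ℓ m q : ℕ} {P : Problem d ℓ m q} (M : Model P) {Ω : Type*}
    {mΩ : MeasurableSpace Ω} (ℙ : Measure Ω) (ℱ : Filtration ℕ mΩ)
    (noise : ℕ → Ω → Fin (q + 1) → ℝ) (move : ℕ → Ω → Move P) (guess : ℕ → Ω → P.A) : Prop where
  subGaussian : SubGaussianNoise ℙ ℱ M.σ noise
  predictable : ∀ n mv, MeasurableSet[ℱ n] {ω | move n ω = mv}
  legal : ∀ n ω, (Memory.after M (fun j => move j ω) (fun j => noise j ω) n).Legal M (n + 1)
    (move n ω)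
  best : ∀ n ω, (Memory.after M (fun j => move j ω) (fun j => noise j ω) (n + 1)).IsBest
    (guess n ω)

end

end GoSafe

namespace GoSafe

noncomputable section

namespace Problem

variable {d ℓ m q : ℕ} {P : Problem d ℓ m q}

/-! ### Geometry of the quantized state space -/

/-! Membership in `Rbar` is a fixed-point argument. Points are finite in number, so the increasing
iterates of `Rglob` become stationary and `Rbar` is fixed by `Rglob` and `Rcon`. The state `x0` is
covered, and a trajectory from it that avoids the border of `Rbar` is then admitted by `Rglob`.

For convergence, suppose first that every confidence interval contains the true value. The safe set
keeps the invariant `SafeSet`. Its engine is `Standing.covered_traj`: the border is so thick that a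
continuous trajectory cannot leave the covered cells without hitting it. Safe sets increase and
hence stabilize; from then on no record is deleted, so the interruptions stabilize too. A point
measured `k` times has posterior variance at most `ρ / k`, while `sqrtBeta n ^ 2 = o(n)`, so by
pigeonhole the first two stages cannot stay active forever. The third stage would enlarge the safe
set or the set of records, so it also runs dry (`exists_exhausted`). An exhausted safe set contains
`Rbar` (`Rbar_subset_of_exhausted`), and the best guess loses at most `ε` (`le_of_isBest`).

Validity of the intervals is probabilistic. The error of the posterior mean is a bias, at most `B`
times the standard deviation, plus a noise term. The latter is controlled by the quadratic form of
`K (K + ρ I)⁻¹` in the noise vector (`sq_noise_le`). Integrating exponentials of the noise over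
Gaussian weights yields exactly the exponential of this form divided by the root of the information
determinant (`mixture_eq`). Along a run this mixture is a nonnegative supermartingale starting at
`1`. Ville's inequality bounds it by `1 / δ` at all times simultaneously, outside an event of
probability at most `δ`; taking logarithms brings in `gamma`. -/

lemma dx_comm (x x' : P.X) : P.dx x x' = P.dx x' x := norm_sub_rev _ _

lemma dx_triangle (x y w : P.X) : P.dx x w ≤ P.dx x y + P.dx y w :=
  norm_sub_le_norm_sub_add_norm_sub _ _ _

lemma da_self (a : P.A) : P.da a a = 0 := by simp [da]

/-- A grid point competes with itself at `L_1`-distance zero, so minimality leaves no other choice.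
The bound `quant_close` alone would not give this. -/
lemma Standing.quant_grid (hP : P.Standing) (x : P.grid) : P.quant x = x := by
  have h := hP.quant_nearest x x
  have h0 : P.dOne x x = 0 := by simp [dOne]
  have h1 : P.dOne x (P.quant x) = 0 :=
    le_antisymm (h.trans h0.le) (Finset.sum_nonneg fun _ _ => abs_nonneg _)
  have h2 := (Finset.sum_eq_zero_iff_of_nonneg (fun _ _ => abs_nonneg _)).1 h1
  apply Subtype.ext
  apply Subtype.ext
  ext j
  have := h2 j (Finset.mem_univ j)
  rw [abs_eq_zero, sub_eq_zero] at this
  exact this.symm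

lemma Standing.traj_zero (hP : P.Standing) (a : P.A) (x : P.X) : P.traj a x 0 = x := by
  have := (hP.traj_spec a x 0 le_rfl).2
  rw [intervalIntegral.integral_same, add_zero] at this
  exact Subtype.ext this

lemma Standing.traj_continuousOn (hP : P.Standing) (a : P.A) (x : P.X) {T : ℝ} (hT : 0 ≤ T) :
    ContinuousOn (fun t => (P.traj a x t : EuclideanSpace ℝ (Fin ℓ))) (Icc 0 T) := by
  have h1 := (hP.traj_spec a x T hT).1
  have h2 := intervalIntegral.continuousOn_primitive_interval' h1 (left_mem_uIcc)
  rw [uIcc_of_le hT] at h2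
  refine ((continuousOn_const (c := (x : EuclideanSpace ℝ (Fin ℓ)))).add h2).congr fun t ht => ?_
  exact (hP.traj_spec a x t ht.1).2

/-- A trajectory which starts in a covered quantized state and never hits the border stays in the
covered quantized states. -/
lemma Standing.covered_traj (hP : P.Standing) {S : Set P.Point} {p : P.Point}
    (hcov : P.Covered S p.2) (hav : P.Avoids p (P.border S)) {T : ℝ} (hT : 0 ≤ T) :
    P.Covered S (P.quant (P.traj p.1 p.2 T)) := by
  -- The border looks `2 * μ` far: one `μ` pays for quantizing the earlier state, the other for the
  -- motion. Uniform continuity below cuts `[0, T]` into steps that each move by less than `μ`.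
  have step : ∀ s t : ℝ, 0 ≤ s → P.Covered S (P.quant (P.traj p.1 p.2 s)) →
      P.dx (P.traj p.1 p.2 s) (P.traj p.1 p.2 t) < P.μ →
      P.Covered S (P.quant (P.traj p.1 p.2 t)) := by
    intro s t hs hc hd
    by_contra hn
    refine hav s hs ⟨hc, P.traj p.1 p.2 t, ?_, hn⟩
    have h1 := dx_triangle (P.quant (P.traj p.1 p.2 s) : P.X) (P.traj p.1 p.2 s)
      (P.traj p.1 p.2 t)
    have h2 := hP.quant_close (P.traj p.1 p.2 s)
    rw [dx_comm] at h2
    linarith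
  have huc := isCompact_Icc.uniformContinuousOn_of_continuous
    (hP.traj_continuousOn p.1 p.2 hT)
  rw [Metric.uniformContinuousOn_iff] at huc
  obtain ⟨η, hη, hu⟩ := huc P.μ hP.μ_pos
  obtain ⟨N, hN⟩ := exists_nat_gt (T / η)
  have hN0 : (0 : ℝ) < N := lt_of_le_of_lt (by positivity) hN
  have hle : ∀ k : ℕ, k ≤ N → (k : ℝ) * (T / N) ∈ Icc (0 : ℝ) T := by
    intro k hk
    have hk' : (k : ℝ) ≤ N := by exact_mod_cast hk
    refine ⟨by positivity, ?_⟩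
    calc (k : ℝ) * (T / N) ≤ N * (T / N) := by gcongr
      _ = T := by field_simp
  have main : ∀ k : ℕ, k ≤ N → P.Covered S (P.quant (P.traj p.1 p.2 (k * (T / N)))) := by
    intro k
    induction k with
    | zero =>
      intro _
      simpa [hP.traj_zero, hP.quant_grid] using hcov
    | succ k ih =>
      intro hk
      refine step _ _ (hle k (by omega)).1 (ih (by omega)) ?_
      have := hu _ (hle k (by omega)) _ (hle (k + 1) hk) ?_
      · rwa [dist_eq_norm] at this
      · rw [Real.dist_eq]
        push_cast
        have : (k : ℝ) * (T / N) - (k + 1) * (T / N) = -(T / N) := by ring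
        rw [this, abs_neg, abs_of_nonneg (by positivity)]
        rwa [div_lt_iff₀ hN0, mul_comm, ← div_lt_iff₀ hη]
  have := main N le_rfl
  rwa [mul_div_cancel₀ _ hN0.ne'] at this

lemma Standing.g_le_gbar (hP : P.Standing) (i : Fin q) (a : P.A) (x : P.X) :
    P.g i a x ≤ P.gbar i x := by
  refine csInf_le (hP.gbar_bddBelow i a x) ⟨0, mem_Ici.2 le_rfl, ?_⟩
  simp [hP.traj_zero]

lemma Standing.le_g_of_lipschitz (hP : P.Standing) (i : Fin q) (a a' : P.A) (x x' : P.X) :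
    P.g i a x - (P.La * P.da a a' + P.Lx * P.dx x x') ≤ P.g i a' x' := by
  have := (abs_le.1 (hP.g_lipschitz i a a' x x')).2
  linarith

/-- If every covered quantized state has parameters that satisfy the constraints with margin
`L_x μ`, then an experiment that starts in a covered state and avoids the border is safe. -/
lemma Standing.g_nonneg_of_avoids (hP : P.Standing) {S : Set P.Point} {p : P.Point}
    (hS : ∀ x, P.Covered S x → ∃ a, ∀ i, P.Lx * P.μ ≤ P.g i a x)
    (hcov : P.Covered S p.2) (hav : P.Avoids p (P.border S)) (i : Fin q) :
    0 ≤ P.g i p.1 p.2 := by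
  refine le_csInf (nonempty_Ici.image _) ?_
  rintro _ ⟨t, ht, rfl⟩
  -- The immediate constraint does not depend on the parameters. Hence any `a` with margin `Lx * μ`
  -- at the quantized state certifies the current state, at most `μ` away, even though the
  -- experiment runs with other parameters.
  obtain ⟨a, ha⟩ := hS _ (hP.covered_traj hcov hav ht)
  have h1 := hP.le_g_of_lipschitz i a a (P.quant (P.traj p.1 p.2 t)) (P.traj p.1 p.2 t)
  have h2 := hP.quant_close (P.traj p.1 p.2 t)
  rw [dx_comm] at h2
  have h3 := hP.g_le_gbar i a (P.traj p.1 p.2 t)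
  have h4 := mul_le_mul_of_nonneg_left h2 hP.Lx_nonneg
  rw [da_self, mul_zero, zero_add] at h1
  linarith [ha i]

/-- `slack` charges `Lx * μ` beyond the Lipschitz loss; this surcharge comes back as the margin that
`SafeSet` asks for. -/
lemma Standing.g_ge_of_slack (hP : P.Standing) {p p' : P.Point} {i : Fin q}
    (h : 0 ≤ P.g i p.1 p.2 - P.slack p p') : P.Lx * P.μ ≤ P.g i p'.1 p'.2 := by
  have := hP.le_g_of_lipschitz i p.1 p'.1 p.2 p'.2
  simp only [slack] at h
  linarith

/-! ### Reachability -/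

lemma Covered.mono {S T : Set P.Point} (h : S ⊆ T) {x : P.grid} (hx : P.Covered S x) :
    P.Covered T x := hx.imp fun _ ha => h ha

lemma subset_Rcon (S : Set P.Point) : S ⊆ P.Rcon S := subset_union_left

lemma Rcon_subset_Rglob (S : Set P.Point) : P.Rcon S ⊆ P.Rglob S := subset_union_left

lemma subset_Rglob (S : Set P.Point) : S ⊆ P.Rglob S :=
  (subset_Rcon S).trans (Rcon_subset_Rglob S)

lemma iterate_Rglob_mono : Monotone fun n : ℕ => P.Rglob^[n] P.S0 := by
  refine monotone_nat_of_le_succ fun n => ?_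
  rw [Function.iterate_succ_apply']
  exact subset_Rglob _

lemma exists_Rbar_eq (P : Problem d ℓ m q) : ∃ n : ℕ, P.Rbar = P.Rglob^[n] P.S0 := by
  obtain ⟨n, hn⟩ := WellFoundedGT.monotone_chain_condition
    (⟨_, iterate_Rglob_mono⟩ : ℕ →o Set P.Point)
  refine ⟨n, subset_antisymm (iUnion_subset fun k => ?_) 
    (subset_iUnion (fun n : ℕ => P.Rglob^[n] P.S0) n)⟩
  rcases le_total k n with h | h
  · exact iterate_Rglob_mono h
  · exact (hn k h).ge

lemma Rglob_Rbar (P : Problem d ℓ m q) : P.Rglob P.Rbar = P.Rbar := by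
  obtain ⟨n, hn⟩ := exists_Rbar_eq P
  refine subset_antisymm ?_ (subset_Rglob _)
  conv_lhs => rw [hn, ← Function.iterate_succ_apply' P.Rglob n]
  exact subset_iUnion (fun n : ℕ => P.Rglob^[n] P.S0) (n + 1)

lemma Rcon_Rbar (P : Problem d ℓ m q) : P.Rcon P.Rbar = P.Rbar :=
  subset_antisymm ((Rcon_subset_Rglob _).trans (Rglob_Rbar P).subset) (subset_Rcon _)

/-- `Rglob` tests against the border of `Rcon`, which at the fixed point is the border of `Rbar`
itself. -/
lemma Standing.mem_Rbar_of_avoids (hP : P.Standing) {a : P.A}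
    (h : P.Avoids (a, P.x0) (P.border P.Rbar)) : (a, P.x0) ∈ P.Rbar := by
  rw [← Rglob_Rbar P]
  refine Or.inr ⟨?_, by rwa [Rcon_Rbar]⟩
  obtain ⟨a', ha'⟩ := hP.seed_nominal
  exact ⟨a', subset_iUnion (fun n : ℕ => P.Rglob^[n] P.S0) 0 ha'⟩

end Problem

variable {d ℓ m q : ℕ} {P : Problem d ℓ m q}

/-! ### Confidence sets and safe sets -/

/-- The confidence sets are bounded and contain the true values. -/
def Valid (C : P.Point → Fin (q + 1) → Set ℝ) : Prop :=
  ∀ (p : P.Point) (i : Fin (q + 1)), P.h p.1 p.2 i ∈ C p i ∧ BddBelow (C p i) ∧ BddAbove (C p i)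

lemma Valid.lo_le {C : P.Point → Fin (q + 1) → Set ℝ} (hC : Valid C) (p : P.Point)
    (i : Fin (q + 1)) : lo C p i ≤ P.h p.1 p.2 i := csInf_le (hC p i).2.1 (hC p i).1

lemma Valid.le_up {C : P.Point → Fin (q + 1) → Set ℝ} (hC : Valid C) (p : P.Point)
    (i : Fin (q + 1)) : P.h p.1 p.2 i ≤ up C p i := le_csSup (hC p i).2.2 (hC p i).1

lemma Valid.lo_mono {C C' : P.Point → Fin (q + 1) → Set ℝ} (hC : Valid C) (hC' : Valid C')
    (h : ∀ p i, C' p i ⊆ C p i) (p : P.Point) (i : Fin (q + 1)) : lo C p i ≤ lo C' p i :=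
  csInf_le_csInf (hC p i).2.1 ⟨_, (hC' p i).1⟩ (h p i)

lemma Valid.up_anti {C C' : P.Point → Fin (q + 1) → Set ℝ} (hC : Valid C) (hC' : Valid C')
    (h : ∀ p i, C' p i ⊆ C p i) (p : P.Point) (i : Fin (q + 1)) : up C' p i ≤ up C p i :=
  csSup_le_csSup (hC p i).2.2 ⟨_, (hC' p i).1⟩ (h p i)

lemma Valid.width_anti {C C' : P.Point → Fin (q + 1) → Set ℝ} (hC : Valid C) (hC' : Valid C')
    (h : ∀ p i, C' p i ⊆ C p i) (p : P.Point) (i : Fin (q + 1)) : width C' p i ≤ width C p i :=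
  sub_le_sub (hC.up_anti hC' h p i) (hC.lo_mono hC' h p i)

lemma subset_expand (C : P.Point → Fin (q + 1) → Set ℝ) (S : Set P.Point) : S ⊆ expand C S :=
  subset_union_right

/-- The points of `S` satisfy the constraints, and every covered state has parameters which satisfy
them with margin `L_x μ`. -/
def SafeSet (S : Set P.Point) : Prop :=
  (∀ p ∈ S, ∀ i : Fin q, 0 ≤ P.g i p.1 p.2) ∧
    ∀ x, P.Covered S x → ∃ a, ∀ i : Fin q, P.Lx * P.μ ≤ P.g i a x

lemma safeSet_seed (hP : P.Standing) : SafeSet P.S0 := by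
  refine ⟨fun p hp i => ?_, fun x ⟨a, ha⟩ => ⟨a, fun i => (hP.seed_safe _ ha i).le⟩⟩
  exact (mul_nonneg hP.Lx_nonneg hP.μ_pos.le).trans (hP.seed_safe p hp i).le

lemma SafeSet.expand (hP : P.Standing) {C : P.Point → Fin (q + 1) → Set ℝ} (hC : Valid C)
    {S : Set P.Point} (hS : SafeSet S) : SafeSet (expand C S) := by
  have key : ∀ p' ∈ (⋂ i : Fin q, ⋃ p ∈ S, {p' | 0 ≤ lo C p i.succ - P.slack p p'}),
      ∀ i : Fin q, P.Lx * P.μ ≤ P.g i p'.1 p'.2 := by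
    intro p' hp' i
    obtain ⟨p, hp, h⟩ := mem_iUnion₂.1 (mem_iInter.1 hp' i)
    refine hP.g_ge_of_slack (p := p) (le_trans h ?_)
    exact sub_le_sub_right (hC.lo_le p i.succ) _
  refine ⟨fun p hp i => ?_, fun x ⟨a, ha⟩ => ?_⟩
  · rcases hp with hp | hp
    · exact (mul_nonneg hP.Lx_nonneg hP.μ_pos.le).trans (key p hp i)
    · exact hS.1 p hp i
  · rcases ha with ha | ha
    · exact ⟨a, key _ ha⟩
    · exact hS.2 x ⟨a, ha⟩

/-- A point validated by an experiment satisfies the constraints with margin zero only. This is why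
the invariant asks for the margin once per covered state rather than at every point; the new point's
state was covered before. -/
lemma SafeSet.union_avoids (hP : P.Standing) {S : Set P.Point} (hS : SafeSet S) {p : P.Point}
    (hcov : P.Covered S p.2) (hav : P.Avoids p (P.border S)) : SafeSet (S ∪ {p}) := by
  refine ⟨fun p' hp' i => ?_, fun x ⟨a, ha⟩ => ?_⟩
  · rcases hp' with hp' | rfl
    · exact hS.1 p' hp' i
    · exact hP.g_nonneg_of_avoids hS.2 hcov hav i
  · rcases ha with ha | ha
    · exact hS.2 x ⟨a, ha⟩
    · refine hS.2 x ?_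
      rw [← ha] at hcov
      exact hcov

/-- A safe set which the algorithm can no longer enlarge contains the reachable set. -/
lemma Rbar_subset_of_exhausted (hP : P.Standing) {C : P.Point → Fin (q + 1) → Set ℝ}
    (hC : Valid C) {S : Set P.Point} {F : Set (P.Point × P.grid)} (hS0 : P.S0 ⊆ S)
    (hexp : expand C S = S)
    (hw : ∀ p ∈ expanders C S, ∀ i : Fin q, width C p i.succ ≤ P.ε)
    (hF : ∀ e ∈ F, e.2 ∈ P.border S ∧
      ∃ t : ℝ, 0 ≤ t ∧ P.quant (P.traj e.1.1 e.1.2 t) = e.2)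
    (h3 : stageThree S F = ∅) : P.Rbar ⊆ S := by
  have hcon : ∀ T ⊆ S, P.Rcon T ⊆ S := by
    rintro T hT p (hp | ⟨p', hp', hp⟩)
    · exact hT hp
    by_contra hpS
    refine hpS (hexp ▸ Or.inl (mem_iInter.2 fun i => mem_iUnion₂.2 ⟨p', hT hp', ?_⟩))
    have h1 := hp i
    have h2 : P.g i p'.1 p'.2 ≤ up C p' i.succ := hC.le_up p' i.succ
    have hG : p' ∈ expanders C S := by
      refine ⟨hT hp', (Set.ncard_pos (Set.toFinite _)).2 ⟨p, hpS, i, ?_⟩⟩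
      linarith [hP.ε_pos]
    have h4 := hw p' hG i
    simp only [width] at h4
    rw [mem_ofPred_eq]
    linarith
  refine iUnion_subset fun n => ?_
  induction n with
  | zero => exact hS0
  | succ n ih =>
    rw [Function.iterate_succ_apply']
    set T := P.Rglob^[n] P.S0
    rintro p (hp | ⟨hcov, hav⟩)
    · exact hcon T ih hp
    by_contra hpS
    have hp3 : p ∉ stageThree S F := by simp [h3]
    -- With the third stage empty, a missing point can only be one recorded as interrupted, at some
    -- `r` on the border of `S`. The trajectory stays covered by `Rcon T`, and an uncovered
    -- neighbour for `S` is uncovered for the smaller `Rcon T`. So `r` lies on that border too,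
    -- against `hav`.
    have : ∃ r, (p, r) ∈ F := by
      by_contra hno
      exact hp3 ⟨hpS, not_exists.1 hno, hcov.mono ih⟩
    obtain ⟨r, hr⟩ := this
    obtain ⟨⟨-, y, hy, hny⟩, t, ht, htr⟩ := hF _ hr
    have hrT := hP.covered_traj (hcov.mono (Problem.subset_Rcon T)) hav ht
    have hnb := hav t ht
    simp only at htr hy
    rw [htr] at hrT hnb
    refine hnb ⟨hrT, y, hy, fun h => hny (h.mono (hcon T ih))⟩

/-- If the widths of the potential maximizers are at most `ε`, a best guess is `ε`-optimal among
all points of the safe set. -/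
lemma le_of_isBest {C : P.Point → Fin (q + 1) → Set ℝ} (hC : Valid C)
    {S : Set P.Point} (hw : ∀ p ∈ maximizers C S, width C p 0 ≤ P.ε) {a b : P.A}
    (hb : (b, P.x0) ∈ S) (hε : 0 < P.ε)
    (ha : ∀ a' : P.A, (a', P.x0) ∈ S → lo C (a', P.x0) 0 ≤ lo C (a, P.x0) 0) :
    P.f b P.x0 - P.ε ≤ P.f a P.x0 := by
  have h1 : lo C (a, P.x0) 0 ≤ P.f a P.x0 := hC.lo_le (a, P.x0) 0
  have h2 : P.f b P.x0 ≤ up C (b, P.x0) 0 := hC.le_up (b, P.x0) 0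
  by_cases hm : (b, P.x0) ∈ maximizers C S
  · have h3 := hw _ hm
    have h4 := ha b hb
    simp only [width] at h3
    linarith
  · have : ∃ a' : P.A, (a', P.x0) ∈ S ∧ up C (b, P.x0) 0 < lo C (a', P.x0) 0 := by
      by_contra hno
      push Not at hno
      exact hm ⟨hb, rfl, hno⟩
    obtain ⟨a', ha', hlt⟩ := this
    linarith [ha a' ha']

lemma expanders_anti {C C' : P.Point → Fin (q + 1) → Set ℝ} (hC : Valid C) (hC' : Valid C')
    (h : ∀ p i, C' p i ⊆ C p i) (S : Set P.Point) : expanders C' S ⊆ expanders C S := by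
  rintro p ⟨hp, hn⟩
  refine ⟨hp, hn.trans_le (Set.ncard_le_ncard ?_ (Set.toFinite _))⟩
  rintro p' ⟨hp', i, hi⟩
  exact ⟨hp', i, hi.trans (sub_le_sub_right (hC.up_anti hC' h p i.succ) _)⟩

lemma maximizers_anti {C C' : P.Point → Fin (q + 1) → Set ℝ} (hC : Valid C) (hC' : Valid C')
    (h : ∀ p i, C' p i ⊆ C p i) (S : Set P.Point) : maximizers C' S ⊆ maximizers C S := by
  rintro p ⟨hp, hx, hm⟩
  exact ⟨hp, hx, fun a' ha' => (hC.lo_mono hC' h _ 0).trans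
    ((hm a' ha').trans (hC.up_anti hC' h p 0))⟩

/-! ### Runs of the algorithm with fixed noise -/

namespace Memory

variable (M : Model P) (n : ℕ) (s : Memory P)

/-- While the safe set is constant, shrinking intervals shrink both the stage domains and the
widths. Together with `CondTwo.anti`, this means that once both conditions fail they keep failing.
-/
lemma CondOne.anti {n n' : ℕ} {s s' : Memory P} {M : Model P} (hC : Valid (s.conf M n))
    (hC' : Valid (s'.conf M n')) (h : ∀ p i, s'.conf M n' p i ⊆ s.conf M n p i)
    (hS : s'.safe M n' = s.safe M n) (h1 : s'.CondOne M n') : s.CondOne M n := by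
  obtain ⟨p, ⟨hp, hx⟩, i, hi⟩ := h1
  rw [hS] at hp
  exact ⟨p, ⟨hp.imp (fun h' => expanders_anti hC hC' h _ h')
    fun h' => maximizers_anti hC hC' h _ h', hx⟩, i, hi.trans_le (hC.width_anti hC' h p i)⟩

lemma CondTwo.anti {n n' : ℕ} {s s' : Memory P} {M : Model P} (hC : Valid (s.conf M n))
    (hC' : Valid (s'.conf M n')) (h : ∀ p i, s'.conf M n' p i ⊆ s.conf M n p i)
    (hS : s'.safe M n' = s.safe M n) (h1 : s'.CondTwo M n') : s.CondTwo M n := by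
  obtain ⟨p, hp, i, hi⟩ := h1
  rw [hS] at hp
  exact ⟨p, expanders_anti hC hC' h _ hp, i, hi.trans_le (hC.width_anti hC' h p i.succ)⟩

lemma subset_nextSafe (mv : Move P) : s.S ⊆ s.nextSafe M n mv := by
  refine (subset_expand _ _).trans (b := s.safe M n) ?_
  cases mv with
  | idle => exact subset_rfl
  | done p => exact subset_union_left
  | stopped p r => exact subset_rfl

lemma safe_subset_nextSafe (mv : Move P) : s.safe M n ⊆ s.nextSafe M n mv := by
  cases mv with
  | idle => exact subset_rfl
  | done p => exact subset_union_left
  | stopped p r => exact subset_rfl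

variable {M n s}

/-- What the legality of a move means for its outcome. -/
lemma Legal.done_cases {p : P.Point} (h : s.Legal M n (.done p)) :
    p ∈ s.safe M n ∨
      (P.Covered (s.safe M n) p.2 ∧ P.Avoids p (P.border (s.safe M n))) := by
  by_cases h1 : s.CondOne M n
  · obtain ⟨p', hp', ⟨⟨hp, -⟩, -⟩⟩ := h.1 h1
    cases hp'
    exact Or.inl (hp.elim (fun h => h.1) fun h => h.1)
  by_cases h2 : s.CondTwo M n
  · obtain ⟨p', hp', ⟨hp, -⟩⟩ := h.2.1 h1 h2
    cases hp'
    exact Or.inl hp.1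
  rcases h.2.2 h1 h2 with ⟨-, h3⟩ | ⟨p', hp', h3⟩
  · cases h3
  rcases h3 with ⟨ha, h3⟩ | ⟨r, -, h3⟩
  · cases h3
    exact Or.inr ⟨hp'.1.2.2, ha⟩
  · cases h3

lemma Legal.stopped_cases {p : P.Point} {r : P.grid} (h : s.Legal M n (.stopped p r)) :
    p ∈ stageThree (s.safe M n) s.F ∧ MayStop (s.safe M n) p r := by
  by_cases h1 : s.CondOne M n
  · obtain ⟨p', hp', -⟩ := h.1 h1
    cases hp'
  by_cases h2 : s.CondTwo M n
  · obtain ⟨p', hp', -⟩ := h.2.1 h1 h2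
    cases hp'
  rcases h.2.2 h1 h2 with ⟨-, h3⟩ | ⟨p', hp', h3⟩
  · cases h3
  rcases h3 with ⟨-, h3⟩ | ⟨r', hr, h3⟩
  · cases h3
  · cases h3
    exact ⟨hp'.1, hr⟩

lemma Legal.exists_width {mv : Move P} (h : s.Legal M n mv)
    (hc : s.CondOne M n ∨ s.CondTwo M n) :
    ∃ p i, mv = .done p ∧ P.ε < width (s.conf M n) p i := by
  by_cases h1 : s.CondOne M n
  · obtain ⟨p, hp, hmax⟩ := h.1 h1
    obtain ⟨p', hp', i', hi'⟩ := h1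
    have hle := hmax.2 p' hp'
    obtain ⟨i, hi⟩ := exists_eq_ciSup_of_finite (f := fun i => width (s.conf M n) p i)
    refine ⟨p, i, hp, ?_⟩
    rw [hi]
    exact hi'.trans_le ((le_ciSup (f := fun i => width (s.conf M n) p' i)
      (Set.finite_range _).bddAbove i').trans hle)
  · have h2 := hc.resolve_left h1
    obtain ⟨p, hp, hmax⟩ := h.2.1 h1 h2
    obtain ⟨p', hp', i', hi'⟩ := h2
    have hle := hmax.2 p' hp'
    have : Nonempty (Fin q) := ⟨i'⟩
    obtain ⟨i, hi⟩ := exists_eq_ciSup_of_finite (f := fun i : Fin q => width (s.conf M n) p i.succ)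
    refine ⟨p, i.succ, hp, ?_⟩
    rw [hi]
    exact hi'.trans_le ((le_ciSup (f := fun i : Fin q => width (s.conf M n) p' i.succ)
      (Set.finite_range _).bddAbove i').trans hle)

end Memory

/-! ### Pigeonhole for repeated measurements -/

/-- An infinite sequence in a finite set returns to one of its values so often that the number of
earlier visits beats any given sequence of order `o(n)`. -/
lemma exists_many_visits {κ : Type*} [Fintype κ] [DecidableEq κ] (c : ℕ → κ) {b : ℕ → ℝ}
    (hb : Monotone b) (hlim : Filter.Tendsto (fun n : ℕ => b n / n) Filter.atTop (nhds 0)) :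
    ∃ n, 1 ≤ ((Finset.range n).filter fun j => c j = c n).card ∧
      b n ≤ ((Finset.range n).filter fun j => c j = c n).card := by
  have hκ : 0 < Fintype.card κ := Fintype.card_pos_iff.2 ⟨c 0⟩
  set K := Fintype.card κ
  have hK : (0 : ℝ) < K := by exact_mod_cast hκ
  have hev : ∀ᶠ n : ℕ in Filter.atTop, b n / n < 1 / (2 * K) :=
    hlim.eventually (gt_mem_nhds (by positivity))
  obtain ⟨n, hn, hnK⟩ := (hev.and (Filter.eventually_ge_atTop (2 * K))).exists
  -- Among the `n + 1` first terms some value occurs at least `(n + 1) / K` times. Its last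
  -- occurrence `n' ≤ n` has at least `(n + 1) / K - 1 ≥ n / (2 * K)` predecessors because `n ≥ 2 *
  -- K`, and this exceeds `b n ≥ b n'`.
  obtain ⟨y, -, hy⟩ := Finset.exists_le_card_fiber_of_nsmul_le_card_of_maps_to
    (s := Finset.range (n + 1)) (t := Finset.univ) (f := c) (b := ((n + 1 : ℕ) : ℝ) / K)
    (fun _ _ => Finset.mem_univ _) ⟨c 0, Finset.mem_univ _⟩
    (by
      rw [nsmul_eq_mul, Finset.card_univ, Finset.card_range, mul_div_cancel₀]
      exact hK.ne')
  set V := (Finset.range (n + 1)).filter fun j => c j = y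
  have hVpos : (0 : ℝ) < V.card := lt_of_lt_of_le (by positivity) hy
  have hV : V.Nonempty := Finset.card_pos.1 (by exact_mod_cast hVpos)
  obtain ⟨hmem, hmax⟩ : V.max' hV ∈ V ∧ ∀ j ∈ V, j ≤ V.max' hV :=
    ⟨V.max'_mem hV, fun j hj => V.le_max' j hj⟩
  set n' := V.max' hV
  obtain ⟨hn'1, hn'2⟩ := Finset.mem_filter.1 hmem
  have hcard : ((Finset.range n').filter fun j => c j = c n').card + 1 = V.card := by
    rw [← Finset.card_erase_add_one hmem]
    congr 2
    ext j
    simp only [Finset.mem_filter, Finset.mem_range, Finset.mem_erase, V]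
    constructor
    · rintro ⟨h1, h2⟩
      exact ⟨h1.ne, by have := Finset.mem_range.1 hn'1; omega, h2.trans hn'2⟩
    · rintro ⟨h1, h2, h3⟩
      refine ⟨lt_of_le_of_ne (hmax j (Finset.mem_filter.2 ⟨Finset.mem_range.2 h2, h3⟩)) h1, ?_⟩
      rw [h3, hn'2]
  have hcard' : (((Finset.range n').filter fun j => c j = c n').card : ℝ) + 1 = V.card := by
    exact_mod_cast hcard
  have hnK' : (2 * K : ℝ) ≤ n := by exact_mod_cast hnK
  have hnpos : (0 : ℝ) < n := by linarith
  have h1 : (n : ℝ) / (2 * K) ≤ ((Finset.range n').filter fun j => c j = c n').card := by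
    have h2 : ((n + 1 : ℕ) : ℝ) / K = 2 * ((n : ℝ) / (2 * K)) + 1 / K := by
      push_cast; field_simp
    have h3 : 1 ≤ (n : ℝ) / (2 * K) := by rw [le_div_iff₀ (by positivity)]; linarith
    have h4 : (0 : ℝ) < 1 / K := by positivity
    linarith
  refine ⟨n', ?_, ?_⟩
  · have h3 : 1 ≤ (n : ℝ) / (2 * K) := by rw [le_div_iff₀ (by positivity)]; linarith
    exact_mod_cast h3.trans h1
  · refine (hb (Nat.lt_succ_iff.1 (Finset.mem_range.1 hn'1))).trans (le_trans ?_ h1)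
    rw [div_lt_iff₀ hnpos] at hn
    calc b n ≤ 1 / (2 * K) * n := hn.le
      _ = n / (2 * K) := by ring

/-! ### Stabilization and exhaustion of a run -/

namespace Memory

variable {M : Model P} {move : ℕ → Move P} {noise : ℕ → Fin (q + 1) → ℝ}

lemma after_succ_S (n : ℕ) :
    (after M move noise (n + 1)).S = (after M move noise n).nextSafe M (n + 1) (move n) := rfl

lemma conf_succ_subset (n : ℕ) (p : P.Point) (i : Fin (q + 1)) :
    (after M move noise (n + 1)).conf M (n + 1 + 1) p i ⊆
      (after M move noise n).conf M (n + 1) p i := inter_subset_left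

lemma mem_C (hP : P.Standing)
    (hQ : ∀ n p i, P.h p.1 p.2 i ∈ M.Q (n + 1) (after M move noise n).data p i) (n : ℕ)
    (p : P.Point) (i : Fin (q + 1)) : P.h p.1 p.2 i ∈ (after M move noise n).C p i := by
  induction n with
  | zero =>
    simp only [after, init]
    split_ifs with h
    · obtain ⟨j, rfl⟩ := Fin.exists_succ_eq.2 h.2
      exact (hP.seed_safe p h.1 j).le
    · trivial
  | succ n ih => exact ⟨ih, hQ n p i⟩

/-- The initial sets are rays or the whole line. Boundedness comes from intersecting with `Q`, so
validity is stated for `conf` and not for the stored `C`. -/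
lemma valid_conf (hP : P.Standing)
    (hQ : ∀ n p i, P.h p.1 p.2 i ∈ M.Q (n + 1) (after M move noise n).data p i) (n : ℕ) :
    Valid ((after M move noise n).conf M (n + 1)) := fun p i =>
  ⟨⟨mem_C hP hQ n p i, hQ n p i⟩, bddBelow_Icc.mono inter_subset_right,
    bddAbove_Icc.mono inter_subset_right⟩

lemma width_conf_le {s : Memory P} {n : ℕ} (hC : Valid (s.conf M n)) (p : P.Point)
    (i : Fin (q + 1)) :
    width (s.conf M n) p i ≤ 2 * (M.sqrtBeta n * M.sd s.data (P.toDom p i)) := by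
  have h1 : up (s.conf M n) p i ≤ _ := csSup_le ⟨_, (hC p i).1⟩ fun x hx => hx.2.2
  have h2 : _ ≤ lo (s.conf M n) p i := le_csInf ⟨_, (hC p i).1⟩ fun x hx => hx.2.1
  simp only [width]
  linarith

lemma monotone_S : Monotone fun n => (after M move noise n).S :=
  monotone_nat_of_le_succ fun n => subset_nextSafe M (n + 1) _ (move n)

lemma safeSet_after (hP : P.Standing)
    (hQ : ∀ n p i, P.h p.1 p.2 i ∈ M.Q (n + 1) (after M move noise n).data p i)
    (hL : ∀ n, (after M move noise n).Legal M (n + 1) (move n)) (n : ℕ) :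
    SafeSet (after M move noise n).S := by
  induction n with
  | zero => exact safeSet_seed hP
  | succ n ih =>
    have h := ih.expand hP (valid_conf hP hQ n)
    rw [after_succ_S]
    have hLn := hL n
    generalize move n = mv at hLn
    cases mv with
    | idle => exact h
    | stopped p r => exact h
    | done p =>
      rcases hLn.done_cases with hp | ⟨hc, ha⟩
      · have : (after M move noise n).nextSafe M (n + 1) (.done p) =
            (after M move noise n).safe M (n + 1) :=
          union_eq_self_of_subset_right (singleton_subset_iff.2 hp)
        rw [this]
        exact h
      · exact SafeSet.union_avoids hP h hc ha

lemma record_spec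
    (hL : ∀ n, (after M move noise n).Legal M (n + 1) (move n)) (n : ℕ) :
    ∀ e ∈ (after M move noise n).F, e.2 ∈ P.border (after M move noise n).S ∧
      ∃ t : ℝ, 0 ≤ t ∧ P.quant (P.traj e.1.1 e.1.2 t) = e.2 := by
  induction n with
  | zero => intro e he; exact he.elim
  | succ n ih =>
    rintro e ⟨he, hb⟩
    refine ⟨hb, ?_⟩
    have hLn := hL n
    generalize move n = mv at hLn he
    cases mv with
    | idle => exact (ih e he).2
    | done p => exact (ih e he).2
    | stopped p r =>
      rcases he with he | rfl
      · exact (ih e he).2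
      · obtain ⟨-, t, ht, htr, -⟩ := hLn.stopped_cases
        exact ⟨t, ht, htr⟩

/-- From some iteration on, the safe set and the set of interrupted experiments are constant. -/
lemma exists_stable (hL : ∀ n, (after M move noise n).Legal M (n + 1) (move n)) :
    ∃ N, ∀ n ≥ N, (after M move noise n).S = (after M move noise N).S ∧
      (after M move noise n).F = (after M move noise N).F := by
  obtain ⟨N₀, h₀⟩ := WellFoundedGT.monotone_chain_condition
    (⟨_, monotone_S (M := M) (move := move) (noise := noise)⟩ : ℕ →o Set P.Point)
  have h₀' : ∀ n ≥ N₀, (after M move noise n).S = (after M move noise N₀).S :=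
    fun n hn => (h₀ n hn).symm
  -- With the safe set frozen, recorded states stay on its border and nothing is deleted, so the
  -- records form an increasing chain in a finite set.
  have hmono : Monotone fun n => (after M move noise (N₀ + n)).F := by
    refine monotone_nat_of_le_succ fun n e he => ⟨?_, ?_⟩
    · generalize move (N₀ + n) = mv
      cases mv with
      | idle => exact he
      | done p => exact he
      | stopped p r => exact Or.inl he
    · have := (record_spec hL _ e he).1
      rw [h₀' (N₀ + n) (Nat.le_add_right _ _)] at this
      change e.2 ∈ P.border (after M move noise (N₀ + n + 1)).S
      rw [h₀' (N₀ + n + 1) (Nat.le_add_right N₀ (n + 1))]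
      exact this
  obtain ⟨N₁, h₁⟩ := WellFoundedGT.monotone_chain_condition
    (⟨_, hmono⟩ : ℕ →o Set (P.Point × P.grid))
  refine ⟨N₀ + N₁, fun n hn => ⟨?_, ?_⟩⟩
  · rw [h₀' _ (by omega), h₀' (N₀ + N₁) (by omega)]
  · obtain ⟨k, rfl⟩ := Nat.exists_eq_add_of_le (show N₀ ≤ n by omega)
    exact (h₁ k (by omega)).symm

/-- The number of completed experiments at `p` before iteration `n + 1`. -/
def visits (move : ℕ → Move P) (n : ℕ) (p : P.Point) : ℕ :=
  {j | j < n ∧ move j = .done p}.ncard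

/-- If the posterior standard deviations vanish fast enough, then from some iteration on none of
the three stages has anything left to do. -/
lemma exists_exhausted (hP : P.Standing)
    (hQ : ∀ n p i, P.h p.1 p.2 i ∈ M.Q (n + 1) (after M move noise n).data p i)
    (hL : ∀ n, (after M move noise n).Legal M (n + 1) (move n))
    {b : ℕ → ℝ} (hb : Monotone b)
    (hlim : Filter.Tendsto (fun n : ℕ => b n / n) Filter.atTop (nhds 0))
    (hw : ∀ n p i, 1 ≤ visits move n p → b n ≤ visits move n p →
      width ((after M move noise n).conf M (n + 1)) p i ≤ P.ε) :
    ∃ N, ∀ n ≥ N, (after M move noise (n + 1)).S = (after M move noise n).S ∧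
      (after M move noise n).safe M (n + 1) = (after M move noise n).S ∧
      ¬ (after M move noise n).CondOne M (n + 1) ∧ ¬ (after M move noise n).CondTwo M (n + 1) ∧
      stageThree (after M move noise n).S (after M move noise n).F = ∅ := by
  classical
  obtain ⟨N, hN⟩ := exists_stable hL
  have hS : ∀ n ≥ N, (after M move noise (n + 1)).S = (after M move noise n).S := fun n hn => by
    rw [(hN n hn).1, (hN (n + 1) (by omega)).1]
  have hF : ∀ n ≥ N, (after M move noise (n + 1)).F = (after M move noise n).F := fun n hn => by
    rw [(hN n hn).2, (hN (n + 1) (by omega)).2]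
  have hsafe : ∀ n ≥ N, (after M move noise n).safe M (n + 1) = (after M move noise n).S :=
    fun n hn => subset_antisymm ((safe_subset_nextSafe M (n + 1) _ (move n)).trans (hS n hn).subset)
      (subset_expand _ _)
  have hanti : ∀ n ≥ N, (after M move noise (n + 1)).CondOne M (n + 1 + 1) ∨
      (after M move noise (n + 1)).CondTwo M (n + 1 + 1) →
      (after M move noise n).CondOne M (n + 1) ∨ (after M move noise n).CondTwo M (n + 1) := by
    intro n hn
    have hSS : (after M move noise (n + 1)).safe M (n + 1 + 1) =
        (after M move noise n).safe M (n + 1) := by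
      rw [hsafe n hn, hsafe (n + 1) (by omega), hS n hn]
    exact Or.imp
      (CondOne.anti (valid_conf hP hQ n) (valid_conf hP hQ (n + 1)) (conf_succ_subset n) hSS)
      (CondTwo.anti (valid_conf hP hQ n) (valid_conf hP hQ (n + 1)) (conf_succ_subset n) hSS)
  have hex : ∃ n₀ ≥ N, ¬ ((after M move noise n₀).CondOne M (n₀ + 1) ∨
      (after M move noise n₀).CondTwo M (n₀ + 1)) := by
    -- Otherwise every iteration from `N` on measures a point of width above `ε`. Some such point
    -- has been measured often enough before for `hw` to bound its width by `ε`. The shift of time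
    -- by `N` does not affect the order `o(n)`.
    by_contra! hall
    have hchoose : ∀ j, ∃ p i, move (N + j) = .done p ∧
        P.ε < width ((after M move noise (N + j)).conf M (N + j + 1)) p i := fun j =>
      (hL (N + j)).exists_width (hall (N + j) (by omega))
    choose c i hc hi using hchoose
    have hb' : Monotone fun j => b (N + j) := fun j k hjk => hb (by omega)
    have hlim' : Filter.Tendsto (fun j : ℕ => b (N + j) / j) Filter.atTop (nhds 0) := by
      have h1 : Filter.Tendsto (fun j : ℕ => b (N + j) / ((N + j : ℕ) : ℝ)) Filter.atTop (nhds 0) :=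
        hlim.comp (Filter.tendsto_atTop_mono (fun j => Nat.le_add_left j N) Filter.tendsto_id)
      have h2 : Filter.Tendsto (fun j : ℕ => ((N + j : ℕ) : ℝ) / j) Filter.atTop (nhds 1) := by
        have h3 : Filter.Tendsto (fun j : ℕ => (N : ℝ) / j + 1) Filter.atTop (nhds (0 + 1)) :=
          (tendsto_const_div_atTop_nhds_zero_nat (N : ℝ)).add_const 1
        rw [zero_add] at h3
        refine h3.congr' ?_
        filter_upwards [Filter.eventually_gt_atTop 0] with j hj
        have : (j : ℝ) ≠ 0 := by positivity
        push_cast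
        field_simp
      have h4 := h1.mul h2
      rw [zero_mul] at h4
      refine h4.congr' ?_
      filter_upwards [Filter.eventually_gt_atTop 0] with j hj
      have : (j : ℝ) ≠ 0 := by positivity
      have : ((N + j : ℕ) : ℝ) ≠ 0 := by positivity
      field_simp
    obtain ⟨n, hn1, hn2⟩ := exists_many_visits c hb' hlim'
    have hvis : ((Finset.range n).filter fun j => c j = c n).card ≤ visits move (N + n) (c n) := by
      rw [visits, ← Set.ncard_coe_finset, ← Set.ncard_image_of_injective _ (add_right_injective N)]
      refine Set.ncard_le_ncard ?_ ((Set.finite_lt_nat (N + n)).subset fun j hj => hj.1)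
      rintro _ ⟨j, hj, rfl⟩
      simp only [Finset.coe_filter, Finset.mem_range, mem_ofPred_eq] at hj
      exact ⟨by simpa using hj.1, by rw [← hj.2]; exact hc j⟩
    refine (hi n).not_ge (hw _ _ _ (hn1.trans hvis) (hn2.trans ?_))
    exact_mod_cast hvis
  obtain ⟨n₀, hn₀, hnot⟩ := hex
  refine ⟨n₀, fun n hn => ?_⟩
  have hnN : n ≥ N := hn₀.trans hn
  have hnot' : ¬ ((after M move noise n).CondOne M (n + 1) ∨
      (after M move noise n).CondTwo M (n + 1)) := by
    induction n, hn using Nat.le_induction with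
    | base => exact hnot
    | succ n hn ih => exact fun h => ih (hn₀.trans hn) (hanti n (hn₀.trans hn) h)
  rw [not_or] at hnot'
  refine ⟨hS n hnN, hsafe n hnN, hnot'.1, hnot'.2, ?_⟩
  -- Any experiment of the third stage contradicts stability: a completed one adds a new point to
  -- the safe set, an interrupted one a new record, which survives the deletion because `r` is on
  -- the unchanged border.
  have hLn := hL n
  rcases hLn.2.2 hnot'.1 hnot'.2 with ⟨h3, -⟩ | ⟨p, hp, ⟨-, hmv⟩ | ⟨r, hr, hmv⟩⟩
  · rwa [hsafe n hnN] at h3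
  · exfalso
    have h1 := hS n hnN
    rw [after_succ_S, hmv, ← hsafe n hnN] at h1
    exact hp.1.1 (h1 ▸ Or.inr rfl)
  · exfalso
    have h1 : (p, r) ∈ (after M move noise (n + 1)).F := by
      refine ⟨by rw [hmv]; exact Or.inr rfl, ?_⟩
      obtain ⟨-, -, -, hb, -⟩ := hr
      rw [← after_succ_S, hS n hnN, ← hsafe n hnN]
      exact hb
    rw [hF n hnN] at h1
    exact hp.1.2.1 r h1

/-- Convergence of the algorithm for fixed noise, given valid confidence intervals and posterior
standard deviations that vanish fast enough. -/
theorem eventually_optimal (hP : P.Standing)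
    (hQ : ∀ n p i, P.h p.1 p.2 i ∈ M.Q (n + 1) (after M move noise n).data p i)
    (hL : ∀ n, (after M move noise n).Legal M (n + 1) (move n))
    {b : ℕ → ℝ} (hb : Monotone b)
    (hlim : Filter.Tendsto (fun n : ℕ => b n / n) Filter.atTop (nhds 0))
    (hw : ∀ n p i, 1 ≤ visits move n p → b n ≤ visits move n p →
      width ((after M move noise n).conf M (n + 1)) p i ≤ P.ε)
    {guess : ℕ → P.A} (hguess : ∀ n, (after M move noise (n + 1)).IsBest (guess n))
    {a : P.A} (ha : (a, P.x0) ∈ P.Rbar) :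
    ∃ N : ℕ, ∀ n ≥ N, P.Feasible (guess n) ∧ P.f a P.x0 - P.ε ≤ P.f (guess n) P.x0 := by
  obtain ⟨N, hN⟩ := exists_exhausted hP hQ hL hb hlim hw
  refine ⟨N, fun n hn => ?_⟩
  obtain ⟨hS, hsafe, h1, h2, h3⟩ := hN n hn
  obtain ⟨hg, hbest⟩ := hguess n
  refine ⟨fun i => (safeSet_after hP hQ hL (n + 1)).1 _ hg i, ?_⟩
  have hV := valid_conf hP hQ n
  have hR : P.Rbar ⊆ (after M move noise n).S := by
    refine Rbar_subset_of_exhausted hP hV (monotone_S (Nat.zero_le n)) hsafe ?_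
      (record_spec hL n) h3
    intro p hp i
    by_contra! hlt
    refine h2 ⟨p, ?_, i, hlt⟩
    rwa [hsafe]
  -- The guess uses the memory after the iteration. Its intervals are by definition those of `conf`,
  -- so only the safe set needs rewriting.
  rw [hS] at hbest
  refine le_of_isBest hV ?_ (hR ha) hP.ε_pos hbest
  intro p hp
  by_contra! hlt
  refine h1 ⟨p, ⟨Or.inr ?_, hp.2.1⟩, 0, hlt⟩
  rwa [hsafe]

end Memory

/-! ### Kernel ridge regression -/

section Regression

open Matrix

variable {ι : Type*} [Fintype ι] [DecidableEq ι] {H : Type*} [NormedAddCommGroup H]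
  [InnerProductSpace ℝ H]

lemma posDef_gram_add {K : Matrix ι ι ℝ} {φ : ι → H} (hK : ∀ i j, K i j = inner ℝ (φ i) (φ j))
    {ρ : ℝ} (hρ : 0 < ρ) : (K + ρ • (1 : Matrix ι ι ℝ)).PosDef := by
  have h1 : K = Matrix.gram ℝ φ := by ext i j; exact hK i j
  rw [h1]
  exact Matrix.PosDef.posSemidef_add (Matrix.posSemidef_gram ℝ φ) (Matrix.PosDef.one.smul hρ)

omit [DecidableEq ι] in
lemma dotProduct_mulVec_gram {K : Matrix ι ι ℝ} {φ : ι → H}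
    (hK : ∀ i j, K i j = inner ℝ (φ i) (φ j)) (a b : ι → ℝ) :
    a ⬝ᵥ K *ᵥ b = inner ℝ (∑ i, a i • φ i) (∑ i, b i • φ i) := by
  simp only [dotProduct, mulVec, sum_inner, inner_sum, inner_smul_left, inner_smul_right, hK,
    Finset.mul_sum, conj_trivial]
  rw [Finset.sum_comm]
  exact Finset.sum_congr rfl fun i _ => Finset.sum_congr rfl fun j _ => by ring

variable {K : Matrix ι ι ℝ} {φ : ι → H} (hK : ∀ i j, K i j = inner ℝ (φ i) (φ j))
  {ρ : ℝ} (hρ : 0 < ρ) {φz : H} {c : ι → ℝ} (hc : ∀ i, c i = inner ℝ φz (φ i))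

omit [DecidableEq ι] in
include hc in
lemma dotProduct_eq_inner (a : ι → ℝ) : c ⬝ᵥ a = inner ℝ φz (∑ i, a i • φ i) := by
  simp only [dotProduct, inner_sum, inner_smul_right, hc, mul_comm]

include hK hρ in
lemma mulVec_inv_mulVec (v : ι → ℝ) :
    (K + ρ • (1 : Matrix ι ι ℝ)) *ᵥ ((K + ρ • (1 : Matrix ι ι ℝ))⁻¹ *ᵥ v) = v := by
  have hdet : IsUnit (K + ρ • (1 : Matrix ι ι ℝ)).det := (posDef_gram_add hK hρ).det_pos.ne'.isUnit
  rw [mulVec_mulVec, mul_nonsing_inv _ hdet, one_mulVec]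

omit [DecidableEq ι] in
include hK hc in
lemma norm_sub_combination_sq (a : ι → ℝ) :
    ‖φz - ∑ i, a i • φ i‖ ^ 2 = inner ℝ φz φz - 2 * (c ⬝ᵥ a) + a ⬝ᵥ K *ᵥ a := by
  rw [dotProduct_mulVec_gram hK, dotProduct_eq_inner hc, ← real_inner_self_eq_norm_sq]
  simp only [inner_sub_left, inner_sub_right, real_inner_comm φz]
  ring

include hK hρ hc in
/-- The posterior variance is the value of the regularized least squares problem. -/
lemma variance_eq :
    inner ℝ φz φz - c ⬝ᵥ (K + ρ • (1 : Matrix ι ι ℝ))⁻¹ *ᵥ c =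
      ‖φz - ∑ i, ((K + ρ • (1 : Matrix ι ι ℝ))⁻¹ *ᵥ c) i • φ i‖ ^ 2 +
        ρ * (((K + ρ • (1 : Matrix ι ι ℝ))⁻¹ *ᵥ c) ⬝ᵥ ((K + ρ • (1 : Matrix ι ι ℝ))⁻¹ *ᵥ c)) := by
  set α := (K + ρ • (1 : Matrix ι ι ℝ))⁻¹ *ᵥ c
  have h1 : K *ᵥ α + ρ • α = c := by
    have := mulVec_inv_mulVec hK hρ c
    rwa [add_mulVec, smul_mulVec, one_mulVec] at this
  have h2 : α ⬝ᵥ K *ᵥ α + ρ * (α ⬝ᵥ α) = c ⬝ᵥ α := by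
    rw [← h1, add_dotProduct, smul_dotProduct, smul_eq_mul, dotProduct_comm]
  rw [norm_sub_combination_sq hK hc]
  linarith

include hK hρ hc in
lemma variance_nonneg :
    0 ≤ inner ℝ φz φz - c ⬝ᵥ (K + ρ • (1 : Matrix ι ι ℝ))⁻¹ *ᵥ c := by
  rw [variance_eq hK hρ hc]
  exact add_nonneg (sq_nonneg _) (mul_nonneg hρ.le (Finset.sum_nonneg fun _ _ => mul_self_nonneg _))

include hK hρ hc in
-- The vector `α` minimizes the ridge functional on the right, with minimum the posterior variance;
-- the excess at `a` is the form of `K + ρ I` at `a - α`. Thus any test vector bounds the variance.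
lemma variance_le (a : ι → ℝ) :
    inner ℝ φz φz - c ⬝ᵥ (K + ρ • (1 : Matrix ι ι ℝ))⁻¹ *ᵥ c ≤
      ‖φz - ∑ i, a i • φ i‖ ^ 2 + ρ * (a ⬝ᵥ a) := by
  set α := (K + ρ • (1 : Matrix ι ι ℝ))⁻¹ *ᵥ c
  have h1 : K *ᵥ α + ρ • α = c := by
    have := mulVec_inv_mulVec hK hρ c
    rwa [add_mulVec, smul_mulVec, one_mulVec] at this
  have hpos : 0 ≤ (a - α) ⬝ᵥ K *ᵥ (a - α) + ρ * ((a - α) ⬝ᵥ (a - α)) := by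
    rw [dotProduct_mulVec_gram hK, real_inner_self_eq_norm_sq]
    exact add_nonneg (sq_nonneg _)
      (mul_nonneg hρ.le (Finset.sum_nonneg fun _ _ => mul_self_nonneg _))
  have hsymm : α ⬝ᵥ K *ᵥ a = a ⬝ᵥ K *ᵥ α := by
    rw [dotProduct_mulVec_gram hK, dotProduct_mulVec_gram hK, real_inner_comm]
  have h2 : α ⬝ᵥ K *ᵥ α + ρ * (α ⬝ᵥ α) = c ⬝ᵥ α := by
    rw [← h1, add_dotProduct, smul_dotProduct, smul_eq_mul, dotProduct_comm]
  have h3 : a ⬝ᵥ K *ᵥ α + ρ * (a ⬝ᵥ α) = c ⬝ᵥ a := by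
    rw [← h1, add_dotProduct, smul_dotProduct, smul_eq_mul, dotProduct_comm (K *ᵥ α),
      dotProduct_comm α]
  rw [norm_sub_combination_sq hK hc]
  simp only [mulVec_sub, sub_dotProduct, dotProduct_sub] at hpos
  rw [hsymm, dotProduct_comm α a] at hpos
  linarith

include hK hρ hc in
/-- The error of the regression for noiseless observations of an element of the Hilbert space. -/
lemma abs_inner_sub_le (F : H) :
    |inner ℝ φz F - ∑ i, ((K + ρ • (1 : Matrix ι ι ℝ))⁻¹ *ᵥ c) i * inner ℝ (φ i) F| ≤
      ‖F‖ * √(inner ℝ φz φz - c ⬝ᵥ (K + ρ • (1 : Matrix ι ι ℝ))⁻¹ *ᵥ c) := by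
  set α := (K + ρ • (1 : Matrix ι ι ℝ))⁻¹ *ᵥ c with hα
  have h1 : inner ℝ φz F - ∑ i, α i * inner ℝ (φ i) F = inner ℝ (φz - ∑ i, α i • φ i) F := by
    simp only [inner_sub_left, sum_inner, inner_smul_left, conj_trivial]
  rw [h1]
  refine (abs_real_inner_le_norm _ _).trans ?_
  rw [mul_comm]
  refine mul_le_mul_of_nonneg_left (Real.le_sqrt_of_sq_le ?_) (norm_nonneg _)
  rw [hα, variance_eq hK hρ hc]
  exact le_add_of_nonneg_right
    (mul_nonneg hρ.le (Finset.sum_nonneg fun _ _ => mul_self_nonneg _))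

include hK hρ hc in
/-- The influence of the noise `r` on the regression. -/
lemma sq_noise_le (r : ι → ℝ) :
    (((K + ρ • (1 : Matrix ι ι ℝ))⁻¹ *ᵥ c) ⬝ᵥ r) ^ 2 ≤
      (inner ℝ φz φz - c ⬝ᵥ (K + ρ • (1 : Matrix ι ι ℝ))⁻¹ *ᵥ c) / ρ *
        (K *ᵥ ((K + ρ • (1 : Matrix ι ι ℝ))⁻¹ *ᵥ r) ⬝ᵥ r) := by
  set α := (K + ρ • (1 : Matrix ι ι ℝ))⁻¹ *ᵥ c with hα
  set β := (K + ρ • (1 : Matrix ι ι ℝ))⁻¹ *ᵥ r with hβ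
  have hr : K *ᵥ β + ρ • β = r := by
    have := mulVec_inv_mulVec hK hρ r
    rwa [add_mulVec, smul_mulVec, one_mulVec] at this
  set y := φz - ∑ i, α i • φ i with hy
  set x := ∑ i, β i • φ i with hx
  have hV : inner ℝ φz φz - c ⬝ᵥ α = ‖y‖ ^ 2 + ρ * (α ⬝ᵥ α) := by
    rw [hα, variance_eq hK hρ hc]
  rw [hV]
  have hcα : K *ᵥ α + ρ • α = c := by
    have := mulVec_inv_mulVec hK hρ c
    rwa [add_mulVec, smul_mulVec, one_mulVec] at this
  have hsymm : α ⬝ᵥ K *ᵥ β = β ⬝ᵥ K *ᵥ α := by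
    rw [dotProduct_mulVec_gram hK, dotProduct_mulVec_gram hK, real_inner_comm]
  -- Symmetry of `K + ρ I` moves the inverse from `c` to `r`; then `φz` splits into the residual `y`
  -- and its regression.
  have h1 : α ⬝ᵥ r = α ⬝ᵥ K *ᵥ β + inner ℝ y x := by
    have e1 : α ⬝ᵥ r = c ⬝ᵥ β := by
      rw [← hr, ← hcα, dotProduct_add, add_dotProduct, hsymm, dotProduct_comm (K *ᵥ α),
        dotProduct_smul, smul_dotProduct]
    rw [e1, dotProduct_eq_inner hc, hy, inner_sub_left, dotProduct_mulVec_gram hK]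
    ring
  have h2 : K *ᵥ β ⬝ᵥ r = K *ᵥ β ⬝ᵥ K *ᵥ β + ρ * ‖x‖ ^ 2 := by
    have e2 : β ⬝ᵥ K *ᵥ β = ‖x‖ ^ 2 := by
      rw [dotProduct_mulVec_gram hK, ← real_inner_self_eq_norm_sq]
    rw [← e2]
    conv_lhs => rw [← hr]
    rw [dotProduct_add, dotProduct_smul, smul_eq_mul, dotProduct_comm _ β]
  rw [h1, h2]
  -- The rest is Cauchy–Schwarz for the pairs `(√ρ α, y)` and `(K β / √ρ, x)`, carried out by
  -- components, with the cross term handled by the inequality of arithmetic and geometric means.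
  have hp : (α ⬝ᵥ K *ᵥ β) ^ 2 ≤ (α ⬝ᵥ α) * (K *ᵥ β ⬝ᵥ K *ᵥ β) := by
    simp only [dotProduct, ← sq]
    exact Finset.sum_mul_sq_le_sq_mul_sq _ _ _
  have hs : (inner ℝ y x) ^ 2 ≤ ‖y‖ ^ 2 * ‖x‖ ^ 2 := by
    rw [← mul_pow]
    exact sq_le_sq' (by linarith [abs_le.1 (abs_real_inner_le_norm y x)]) (real_inner_le_norm y x)
  have ha : 0 ≤ α ⬝ᵥ α := Finset.sum_nonneg fun _ _ => mul_self_nonneg _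
  have hb : 0 ≤ K *ᵥ β ⬝ᵥ K *ᵥ β := Finset.sum_nonneg fun _ _ => mul_self_nonneg _
  generalize α ⬝ᵥ K *ᵥ β = u at *
  generalize inner ℝ y x = w at *
  generalize α ⬝ᵥ α = a at *
  generalize K *ᵥ β ⬝ᵥ K *ᵥ β = b at *
  have hn1 : 0 ≤ ‖y‖ ^ 2 := sq_nonneg _
  have hn2 : 0 ≤ ‖x‖ ^ 2 := sq_nonneg _
  generalize ‖y‖ ^ 2 = e at *
  generalize ‖x‖ ^ 2 = g at *
  have h5 : 2 * (u * w) ≤ ρ * a * g + e / ρ * b := by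
    have h6 : (u * w) ^ 2 ≤ (ρ * a * g) * (e / ρ * b) := by
      calc (u * w) ^ 2 = u ^ 2 * w ^ 2 := by ring
        _ ≤ (a * b) * (e * g) := mul_le_mul hp hs (sq_nonneg _) (by positivity)
        _ = _ := by field_simp
    have h7 : 0 ≤ ρ * a * g := by positivity
    have h8 : 0 ≤ e / ρ * b := by positivity
    have h9 : (2 * (u * w)) ^ 2 ≤ (ρ * a * g + e / ρ * b) ^ 2 := by
      nlinarith [sq_nonneg (ρ * a * g - e / ρ * b)]
    exact (le_abs_self _).trans (abs_le_of_sq_le_sq h9 (by positivity))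
  calc (u + w) ^ 2 = u ^ 2 + 2 * (u * w) + w ^ 2 := by ring
    _ ≤ a * b + (ρ * a * g + e / ρ * b) + e * g := by linarith
    _ = (e + ρ * a) / ρ * (b + ρ * g) := by field_simp; ring

end Regression

/-! ### Gaussian integrals and determinants -/

section Gaussian

open Matrix

variable {κ : Type*} [Fintype κ]

/-- The total mass of the unnormalized standard Gaussian measure. -/
def gaussMass (κ : Type*) [Fintype κ] : ENNReal :=
  ∫⁻ x : κ → ℝ, ENNReal.ofReal (Real.exp (-(x ⬝ᵥ x) / 2))

lemma gaussMass_eq : gaussMass κ =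
    ENNReal.ofReal (√(2 * Real.pi) ^ Fintype.card κ) := by
  have hprod : ∀ x : κ → ℝ, Real.exp (-(x ⬝ᵥ x) / 2) =
      ∏ i, Real.exp (-(1 / 2) * x i ^ 2) := by
    intro x
    rw [← Real.exp_sum]
    congr 1
    rw [dotProduct, ← Finset.mul_sum]
    simp only [← sq]
    ring
  have h1 : Integrable fun x : κ → ℝ => ∏ i, Real.exp (-(1 / 2) * x i ^ 2) :=
    Integrable.fintype_prod (f := fun _ (t : ℝ) => Real.exp (-(1 / 2) * t ^ 2))
      fun _ => integrable_exp_neg_mul_sq (by norm_num)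
  simp only [gaussMass, hprod]
  rw [← ofReal_integral_eq_lintegral_ofReal h1
    (ae_of_all _ fun x => Finset.prod_nonneg fun _ _ => (Real.exp_pos _).le),
    integral_fintype_prod_volume_eq_pow (fun t : ℝ => Real.exp (-(1 / 2) * t ^ 2)),
    integral_gaussian]
  congr 4
  ring

lemma gaussMass_ne_zero : gaussMass κ ≠ 0 := by
  rw [gaussMass_eq]
  exact (ENNReal.ofReal_pos.2 (by positivity)).ne'

lemma gaussMass_ne_top : gaussMass κ ≠ ⊤ := by
  rw [gaussMass_eq]
  exact ENNReal.ofReal_ne_top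

variable [DecidableEq κ]

open scoped MatrixOrder in
lemma exists_transpose_mul_self {A : Matrix κ κ ℝ} (hA : A.PosSemidef) :
    ∃ B : Matrix κ κ ℝ, A = Bᵀ * B := by
  obtain ⟨B, hB⟩ := CStarAlgebra.nonneg_iff_eq_star_mul_self.mp hA.nonneg
  exact ⟨B, by rw [hB, star_eq_conjTranspose, conjTranspose_eq_transpose_of_trivial]⟩

/-- The Laplace transform of a Gaussian density. -/
lemma lintegral_gaussian {A : Matrix κ κ ℝ} (hA : A.PosDef) {b c : κ → ℝ} (hc : A *ᵥ c = b) :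
    ∫⁻ x : κ → ℝ, ENNReal.ofReal (Real.exp (b ⬝ᵥ x - (x ⬝ᵥ A *ᵥ x) / 2)) =
      ENNReal.ofReal (Real.exp ((b ⬝ᵥ c) / 2) / √A.det) * gaussMass κ := by
  obtain ⟨B, rfl⟩ := exists_transpose_mul_self hA.posSemidef
  have hdet : (Bᵀ * B).det = B.det ^ 2 := by rw [det_mul, det_transpose, sq]
  have hB : B.det ≠ 0 := by
    intro h0
    have := hA.det_pos
    rw [hdet, h0] at this
    simp at this
  have hquad : ∀ x : κ → ℝ, x ⬝ᵥ (Bᵀ * B) *ᵥ x = B *ᵥ x ⬝ᵥ B *ᵥ x := by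
    intro x
    rw [← mulVec_mulVec, dotProduct_mulVec, vecMul_transpose]
  have hbx : ∀ x : κ → ℝ, b ⬝ᵥ x = B *ᵥ c ⬝ᵥ B *ᵥ x := by
    intro x
    rw [← hc, ← mulVec_mulVec, dotProduct_comm, dotProduct_mulVec, vecMul_transpose,
      dotProduct_comm]
  -- Completing the square about the centre `c`; translation and the linear substitution by `B` then
  -- reduce to the standard Gaussian, at the cost of `|det B|⁻¹`.
  have hsq : ∀ x : κ → ℝ, b ⬝ᵥ x - (x ⬝ᵥ (Bᵀ * B) *ᵥ x) / 2 =
      (b ⬝ᵥ c) / 2 + -(B *ᵥ (x - c) ⬝ᵥ B *ᵥ (x - c)) / 2 := by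
    intro x
    rw [hquad, hbx x, hbx c, mulVec_sub, sub_dotProduct, dotProduct_sub, dotProduct_sub,
      dotProduct_comm (B *ᵥ x) (B *ᵥ c)]
    ring
  have hmeas : Measurable fun y : κ → ℝ => ENNReal.ofReal (Real.exp (-(y ⬝ᵥ y) / 2)) := by
    unfold dotProduct
    fun_prop
  simp only [hsq, Real.exp_add, ENNReal.ofReal_mul (Real.exp_pos _).le]
  rw [lintegral_const_mul']
  swap
  · exact ENNReal.ofReal_ne_top
  rw [lintegral_sub_right_eq_self (μ := (volume : Measure (κ → ℝ)))
    (fun x => ENNReal.ofReal (Real.exp (-(B *ᵥ x ⬝ᵥ B *ᵥ x) / 2))) c]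
  have hcv : ∫⁻ x : κ → ℝ, ENNReal.ofReal (Real.exp (-(B *ᵥ x ⬝ᵥ B *ᵥ x) / 2)) =
      ENNReal.ofReal |B.det⁻¹| * gaussMass κ := by
    have h1 := lintegral_map (μ := (volume : Measure (κ → ℝ))) hmeas
      (LinearMap.continuous_on_pi (toLin' B)).measurable
    rw [Real.map_matrix_volume_pi_eq_smul_volume_pi hB, lintegral_smul_measure] at h1
    simpa [gaussMass, toLin'_apply] using h1.symm
  rw [hcv, ← mul_assoc, ← ENNReal.ofReal_mul (Real.exp_pos _).le, hdet, Real.sqrt_sq_eq_abs,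
    abs_inv, ← div_eq_mul_inv]

/-- The determinant is monotone on positive definite matrices. -/
lemma det_le_det_of_quadratic_le {A A' : Matrix κ κ ℝ} (hA : A.PosDef) (hA' : A'.PosDef)
    (h : ∀ x : κ → ℝ, x ⬝ᵥ A *ᵥ x ≤ x ⬝ᵥ A' *ᵥ x) : A.det ≤ A'.det := by
  -- Without linear term the Gaussian integral is a fixed multiple of the inverse root of the
  -- determinant, and its integrand decreases as the form grows. No eigenvalues are needed.
  have h1 := lintegral_gaussian hA (mulVec_zero A)
  have h2 := lintegral_gaussian hA' (mulVec_zero A')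
  have h3 : ∫⁻ x : κ → ℝ, ENNReal.ofReal (Real.exp ((0 : κ → ℝ) ⬝ᵥ x - (x ⬝ᵥ A' *ᵥ x) / 2)) ≤
      ∫⁻ x : κ → ℝ, ENNReal.ofReal (Real.exp ((0 : κ → ℝ) ⬝ᵥ x - (x ⬝ᵥ A *ᵥ x) / 2)) := by
    refine lintegral_mono fun x => ENNReal.ofReal_le_ofReal (Real.exp_le_exp.2 ?_)
    linarith [h x]
  rw [h1, h2, ENNReal.mul_le_mul_iff_left gaussMass_ne_zero gaussMass_ne_top,
    ENNReal.ofReal_le_ofReal_iff (by positivity)] at h3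
  simp only [dotProduct_zero, zero_div, Real.exp_zero] at h3
  rw [one_div_le_one_div (Real.sqrt_pos.2 hA'.det_pos) (Real.sqrt_pos.2 hA.det_pos)] at h3
  exact (Real.sqrt_le_sqrt_iff hA'.det_pos.le).1 h3

variable {ι : Type*} [Fintype ι]

lemma posDef_one_add_smul (Φ : Matrix ι κ ℝ) {s : ℝ} (hs : 0 ≤ s) :
    (1 + s • (Φᵀ * Φ)).PosDef := by
  refine Matrix.PosDef.add_posSemidef Matrix.PosDef.one ?_
  have h := Matrix.posSemidef_conjTranspose_mul_self Φ
  rw [conjTranspose_eq_transpose_of_trivial] at h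
  exact h.smul hs

lemma quadratic_one_add_smul (Φ : Matrix ι κ ℝ) (s : ℝ) (x : κ → ℝ) :
    x ⬝ᵥ (1 + s • (Φᵀ * Φ)) *ᵥ x = x ⬝ᵥ x + s * ∑ j, (Φ j ⬝ᵥ x) ^ 2 := by
  rw [add_mulVec, one_mulVec, dotProduct_add, smul_mulVec, dotProduct_smul, ← mulVec_mulVec,
    dotProduct_mulVec, vecMul_transpose, smul_eq_mul]
  simp [dotProduct, mulVec, sq]

lemma det_one_add_smul_comm [DecidableEq ι] (Φ : Matrix ι κ ℝ) (s : ℝ) :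
    (1 + s • (Φ * Φᵀ)).det = (1 + s • (Φᵀ * Φ)).det := by
  rw [← Matrix.smul_mul, det_one_add_mul_comm, Matrix.mul_smul]

end Gaussian

/-! ### Information capacity -/

section Capacity

open Matrix

variable {d ℓ m q : ℕ} {P : Problem d ℓ m q}

/-- The kernel is given on the quantized domain by the finite-dimensional features `b`. -/
def IsFeature (M : Model P) {κ : Type*} [Fintype κ] (b : P.Point × Fin (q + 1) → κ → ℝ) : Prop :=
  ∀ u u' : P.Point × Fin (q + 1),
    M.k (P.toDom u.1 u.2) (P.toDom u'.1 u'.2) = b u ⬝ᵥ b u'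

/-- Only the finite quantized domain matters, and a factorization of its Gram matrix gives features
in finite dimension. Gaussian integrals over weights thus make sense whatever the dimension of `H`.
-/
lemma exists_isFeature (M : Model P) {H : Type*} [NormedAddCommGroup H] [InnerProductSpace ℝ H]
    {φ : P.Dom → H} (hk : ∀ u v, M.k u v = inner ℝ (φ u) (φ v)) :
    ∃ b : P.Point × Fin (q + 1) → P.Point × Fin (q + 1) → ℝ, IsFeature M b := by
  classical
  obtain ⟨B, hB⟩ := exists_transpose_mul_self
    (Matrix.posSemidef_gram ℝ fun u : P.Point × Fin (q + 1) => φ (P.toDom u.1 u.2))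
  refine ⟨fun u => Bᵀ u, fun u u' => ?_⟩
  rw [hk]
  exact congrFun (congrFun hB u) u'

variable {M : Model P} {κ : Type*} [Fintype κ] [DecidableEq κ]
  {b : P.Point × Fin (q + 1) → κ → ℝ} (hb : IsFeature M b)

/-- The information matrix of measurements at `u` in feature space. -/
def infoMat (M : Model P) (b : P.Point × Fin (q + 1) → κ → ℝ) {ι : Type*} [Fintype ι]
    (u : ι → P.Point × Fin (q + 1)) : Matrix κ κ ℝ :=
  1 + M.ρ⁻¹ • ((Matrix.of fun j => b (u j))ᵀ * (Matrix.of fun j => b (u j)))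

lemma posDef_infoMat (hρ : 0 < M.ρ) {ι : Type*} [Fintype ι] (u : ι → P.Point × Fin (q + 1)) :
    (infoMat M b u).PosDef := posDef_one_add_smul _ (inv_nonneg.2 hρ.le)

lemma quadratic_infoMat {ι : Type*} [Fintype ι] (u : ι → P.Point × Fin (q + 1)) (x : κ → ℝ) :
    x ⬝ᵥ infoMat M b u *ᵥ x = x ⬝ᵥ x + M.ρ⁻¹ * ∑ j, (b (u j) ⬝ᵥ x) ^ 2 :=
  quadratic_one_add_smul _ _ _

omit [DecidableEq κ] in
include hb in
lemma gram_eq_feature {ι : Type*} (u : ι → P.Point × Fin (q + 1)) :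
    M.gram (fun j => P.toDom (u j).1 (u j).2) =
      (Matrix.of fun j => b (u j)) * (Matrix.of fun j => b (u j))ᵀ := by
  ext i j
  exact hb (u i) (u j)

include hb in
lemma det_gram_eq_det_infoMat {ι : Type*} [Fintype ι] [DecidableEq ι]
    (u : ι → P.Point × Fin (q + 1)) :
    (1 + M.ρ⁻¹ • M.gram (fun j => P.toDom (u j).1 (u j).2)).det = (infoMat M b u).det := by
  rw [gram_eq_feature hb, det_one_add_smul_comm]
  rfl

lemma gamma_bddAbove (N : ℕ) : BddAbove (range fun u : Fin N → P.Point × Fin (q + 1) =>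
    (1 / 2) * Real.log
      (1 + M.ρ⁻¹ • M.gram (fun j => P.toDom (u j).1 (u j).2)).det) :=
  (Set.finite_range _).bddAbove

include hb in
/-- The information gain of at most `N` measurements is at most the information capacity. -/
lemma log_det_le_gamma (hρ : 0 < M.ρ) [Nonempty P.Point] {ι : Type*} [Fintype ι]
    (u : ι → P.Point × Fin (q + 1)) {N : ℕ} (hN : Fintype.card ι ≤ N) :
    (1 / 2) * Real.log (infoMat M b u).det ≤ M.gamma N := by
  classical
  obtain ⟨e⟩ : Nonempty (ι ↪ Fin N) := Function.Embedding.nonempty_of_card_le (by simpa using hN)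
  obtain ⟨u₀⟩ : Nonempty (P.Point × Fin (q + 1)) := inferInstance
  -- Fewer than `N` measurements are padded by an arbitrary point: extra measurements only increase
  -- the information form, hence its determinant.
  set u' : Fin N → P.Point × Fin (q + 1) := Function.extend e u fun _ => u₀ with hu'
  have hue : ∀ j, u' (e j) = u j := fun j => e.injective.extend_apply _ _ _
  have hdet : (infoMat M b u).det ≤ (infoMat M b u').det := by
    refine det_le_det_of_quadratic_le (posDef_infoMat hρ u) (posDef_infoMat hρ u') fun x => ?_
    rw [quadratic_infoMat, quadratic_infoMat]
    have : ∑ j, (b (u j) ⬝ᵥ x) ^ 2 ≤ ∑ j, (b (u' j) ⬝ᵥ x) ^ 2 := by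
      calc ∑ j, (b (u j) ⬝ᵥ x) ^ 2 = ∑ k ∈ Finset.univ.map e, (b (u' k) ⬝ᵥ x) ^ 2 := by
            rw [Finset.sum_map]; simp only [hue]
        _ ≤ _ := Finset.sum_le_sum_of_subset_of_nonneg (Finset.subset_univ _)
            fun _ _ _ => sq_nonneg _
    have h2 := mul_le_mul_of_nonneg_left this (inv_nonneg.2 hρ.le)
    linarith
  have h1 := le_ciSup (gamma_bddAbove (M := M) N) u'
  refine le_trans ?_ h1
  rw [det_gram_eq_det_infoMat hb]
  exact mul_le_mul_of_nonneg_left (Real.log_le_log (posDef_infoMat hρ u).det_pos hdet) (by norm_num)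

include hb in
lemma gamma_nonneg (hρ : 0 < M.ρ) [Nonempty P.Point] (N : ℕ) : 0 ≤ M.gamma N := by
  have h := log_det_le_gamma hb hρ (Fin.elim0 : Fin 0 → P.Point × Fin (q + 1)) (N := N) (by simp)
  have h1 : infoMat M b (Fin.elim0 : Fin 0 → P.Point × Fin (q + 1)) = 1 := by
    simp [infoMat]
  simpa [h1] using h

include hb in
lemma gamma_mono (hρ : 0 < M.ρ) [Nonempty P.Point] : Monotone M.gamma := by
  intro N N' h
  refine ciSup_le fun u => ?_
  rw [det_gram_eq_det_infoMat hb]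
  exact log_det_le_gamma hb hρ u (by simpa using h)

include hb in
/-- The information capacity grows at most logarithmically. -/
lemma exists_gamma_le (hρ : 0 < M.ρ) [Nonempty P.Point] :
    ∃ c : ℝ, 0 ≤ c ∧ ∀ N : ℕ,
      M.gamma N ≤ (1 / 2) * (Fintype.card κ * Real.log (1 + c * N)) := by
  set c₀ := ∑ u : P.Point × Fin (q + 1), b u ⬝ᵥ b u
  have hnn : ∀ u, 0 ≤ b u ⬝ᵥ b u := fun u => Finset.sum_nonneg fun _ _ => mul_self_nonneg _
  have hc₀ : 0 ≤ c₀ := Finset.sum_nonneg fun u _ => hnn u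
  have hc : 0 ≤ M.ρ⁻¹ * c₀ := mul_nonneg (inv_nonneg.2 hρ.le) hc₀
  refine ⟨M.ρ⁻¹ * c₀, hc, fun N => ciSup_le fun u => ?_⟩
  rw [det_gram_eq_det_infoMat hb]
  refine mul_le_mul_of_nonneg_left ?_ (by norm_num)
  have hpos : 0 < 1 + M.ρ⁻¹ * c₀ * N := by positivity
  rw [← Real.log_pow]
  refine Real.log_le_log (posDef_infoMat hρ u).det_pos ?_
  have hdet : ((1 + M.ρ⁻¹ * c₀ * N) • (1 : Matrix κ κ ℝ)).det =
      (1 + M.ρ⁻¹ * c₀ * N) ^ Fintype.card κ := by rw [det_smul, det_one, mul_one]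
  rw [← hdet]
  -- The constant `c₀` dominates the squared norm of every feature, so the information matrix lies
  -- below a multiple of the identity that is linear in `N`; its determinant is polynomial in `N`.
  refine det_le_det_of_quadratic_le (posDef_infoMat hρ u) (Matrix.PosDef.one.smul hpos)
    fun x => ?_
  rw [quadratic_infoMat, smul_mulVec, one_mulVec, dotProduct_smul, smul_eq_mul]
  have h1 : ∀ j, (b (u j) ⬝ᵥ x) ^ 2 ≤ c₀ * (x ⬝ᵥ x) := by
    intro j
    calc (b (u j) ⬝ᵥ x) ^ 2 ≤ (b (u j) ⬝ᵥ b (u j)) * (x ⬝ᵥ x) := by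
          simp only [dotProduct, ← sq]
          exact Finset.sum_mul_sq_le_sq_mul_sq _ _ _
      _ ≤ c₀ * (x ⬝ᵥ x) := by
          refine mul_le_mul_of_nonneg_right ?_
            (Finset.sum_nonneg fun _ _ => mul_self_nonneg _)
          exact Finset.single_le_sum (f := fun u => b u ⬝ᵥ b u) (fun u _ => hnn u)
            (Finset.mem_univ (u j))
  have h2 : ∑ j, (b (u j) ⬝ᵥ x) ^ 2 ≤ N * (c₀ * (x ⬝ᵥ x)) := by
    refine (Finset.sum_le_sum fun j _ => h1 j).trans ?_
    simp
  have h3 := mul_le_mul_of_nonneg_left h2 (inv_nonneg.2 hρ.le)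
  calc x ⬝ᵥ x + M.ρ⁻¹ * ∑ j, (b (u j) ⬝ᵥ x) ^ 2
      ≤ x ⬝ᵥ x + M.ρ⁻¹ * (N * (c₀ * (x ⬝ᵥ x))) := by linarith
    _ = _ := by ring

/-! ### The scaling of the confidence intervals -/

include hb in
lemma confidence_radicand_nonneg (hρ : 0 < M.ρ) [Nonempty P.Point] (hδ : 0 < M.δ) (hδ1 : M.δ < 1)
    (N : ℕ) : 0 ≤ M.gamma N + 1 + Real.log (1 / M.δ) := by
  have h1 := gamma_nonneg hb hρ N
  have h2 : 0 ≤ Real.log (1 / M.δ) := Real.log_nonneg (by rw [le_div_iff₀ hδ]; linarith)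
  linarith

lemma sqrtBeta_nonneg (hB : 0 ≤ M.B) (hσ : 0 ≤ M.σ) (n : ℕ) : 0 ≤ M.sqrtBeta n := by
  unfold Model.sqrtBeta
  positivity

include hb in
lemma sqrtBeta_mono (hρ : 0 < M.ρ) [Nonempty P.Point] (hσ : 0 ≤ M.σ) : Monotone M.sqrtBeta := by
  intro n n' h
  unfold Model.sqrtBeta
  have h1 := gamma_mono hb hρ (Nat.mul_le_mul_right (q + 1) (Nat.sub_le_sub_right h 1))
  gcongr

include hb in
/-- The scaling factor grows slower than any multiple of `√n`. -/
lemma tendsto_sqrtBeta_sq_div (hρ : 0 < M.ρ) [Nonempty P.Point] (hδ : 0 < M.δ) (hδ1 : M.δ < 1) :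
    Filter.Tendsto (fun n : ℕ => M.sqrtBeta (n + 1) ^ 2 / n) Filter.atTop (nhds 0) := by
  obtain ⟨c, hc, hγ⟩ := exists_gamma_le hb hρ
  set L := Real.log (1 / M.δ)
  -- This crude bound suffices: it makes the squared scaling factor of order `√n`.
  have hlog : ∀ x : ℝ, 0 ≤ x → Real.log (1 + x) ≤ 2 * √(1 + x) := by
    intro x hx
    have h1 : Real.log (1 + x) = 2 * Real.log √(1 + x) := by
      rw [Real.log_sqrt (by linarith)]; ring
    rw [h1]
    have := Real.log_le_sub_one_of_pos (Real.sqrt_pos.2 (show 0 < 1 + x by linarith))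
    linarith
  set κc : ℝ := (Fintype.card κ : ℝ)
  set e : ℝ := c * (q + 1)
  have hκc : 0 ≤ κc := Nat.cast_nonneg _
  have he : 0 ≤ e := by positivity
  set C₁ : ℝ := 2 * M.B ^ 2 + 32 * M.σ ^ 2 * (1 + |L|)
  set C₂ : ℝ := 32 * M.σ ^ 2 * (κc * √(1 + e))
  have hbound : ∀ n : ℕ, 1 ≤ n → M.sqrtBeta (n + 1) ^ 2 ≤ C₁ + C₂ * √n := by
    intro n hn
    have hn' : (1 : ℝ) ≤ n := by exact_mod_cast hn
    have h0 := confidence_radicand_nonneg hb hρ hδ hδ1 (n * (q + 1))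
    have h1 : M.sqrtBeta (n + 1) ^ 2 ≤
        2 * M.B ^ 2 + 32 * M.σ ^ 2 * (M.gamma (n * (q + 1)) + 1 + L) := by
      have hs : √(M.gamma (n * (q + 1)) + 1 + L) ^ 2 = M.gamma (n * (q + 1)) + 1 + L :=
        Real.sq_sqrt h0
      have : M.sqrtBeta (n + 1) = M.B + 4 * M.σ * √(M.gamma (n * (q + 1)) + 1 + L) := by
        simp [Model.sqrtBeta, L]
      rw [this]
      calc (M.B + 4 * M.σ * √(M.gamma (n * (q + 1)) + 1 + L)) ^ 2
          ≤ 2 * M.B ^ 2 + 32 * M.σ ^ 2 * √(M.gamma (n * (q + 1)) + 1 + L) ^ 2 := by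
            nlinarith [sq_nonneg (M.B - 4 * M.σ * √(M.gamma (n * (q + 1)) + 1 + L))]
        _ = _ := by rw [hs]
    have h2 : M.gamma (n * (q + 1)) ≤ κc * (√(1 + e) * √n) := by
      refine (hγ _).trans ?_
      have h3 := hlog (e * n) (by positivity)
      have h4 : √(1 + e * n) ≤ √(1 + e) * √n := by
        rw [← Real.sqrt_mul (by positivity)]
        exact Real.sqrt_le_sqrt (by nlinarith)
      have h5 : c * ((n * (q + 1) : ℕ) : ℝ) = e * n := by push_cast; ring
      rw [h5]
      have h6 : κc * Real.log (1 + e * n) ≤ κc * (2 * (√(1 + e) * √n)) :=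
        mul_le_mul_of_nonneg_left (h3.trans (by linarith)) hκc
      linarith
    have h7 : M.gamma (n * (q + 1)) + 1 + L ≤ κc * (√(1 + e) * √n) + 1 + |L| := by
      linarith [le_abs_self L]
    have h8 := mul_le_mul_of_nonneg_left h7 (show 0 ≤ 32 * M.σ ^ 2 by positivity)
    calc _ ≤ _ := h1
      _ ≤ 2 * M.B ^ 2 + 32 * M.σ ^ 2 * (κc * (√(1 + e) * √n) + 1 + |L|) := by linarith
      _ = C₁ + C₂ * √n := by simp only [C₁, C₂]; ring
  have hlim : Filter.Tendsto (fun n : ℕ => C₁ / n + C₂ * (1 / √(n : ℝ))) Filter.atTop (nhds 0) := by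
    have h1 : Filter.Tendsto (fun n : ℕ => 1 / √(n : ℝ)) Filter.atTop (nhds 0) := by
      simp only [one_div]
      exact tendsto_inv_atTop_zero.comp
        (Real.tendsto_sqrt_atTop.comp tendsto_natCast_atTop_atTop)
    simpa using (tendsto_const_div_atTop_nhds_zero_nat C₁).add (h1.const_mul C₂)
  refine squeeze_zero' (Filter.Eventually.of_forall fun n => by positivity) ?_ hlim
  filter_upwards [Filter.eventually_ge_atTop 1] with n hn
  have hn' : (0 : ℝ) < n := by exact_mod_cast hn
  have hs : 0 < √(n : ℝ) := Real.sqrt_pos.2 hn'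
  calc M.sqrtBeta (n + 1) ^ 2 / n ≤ (C₁ + C₂ * √n) / n := by
        gcongr; exact hbound n hn
    _ = C₁ / n + C₂ * (1 / √(n : ℝ)) := by
        have : √(n : ℝ) / n = 1 / √(n : ℝ) := by
          rw [div_eq_div_iff hn'.ne' hs.ne', Real.mul_self_sqrt hn'.le, one_mul]
        rw [add_div, mul_div_assoc, this]

end Capacity

section Confidence

open Matrix

variable {d ℓ m q : ℕ} {P : Problem d ℓ m q}

/-! ### Confidence intervals from a bound on the mixture martingale -/

/-- The measurement noise in a datum. -/
def resid (e : P.Datum) (i : Fin (q + 1)) : ℝ := e.2 i - P.h e.1.1 e.1.2 i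

/-- The log-likelihood of a datum under the feature weights `x`. -/
def logWeight (M : Model P) {κ : Type*} [Fintype κ] (b : P.Point × Fin (q + 1) → κ → ℝ)
    (x : κ → ℝ) (e : P.Datum) : ℝ :=
  ∑ i, ((√M.ρ * M.σ)⁻¹ * (b (e.1, i) ⬝ᵥ x) * resid e i - (b (e.1, i) ⬝ᵥ x) ^ 2 / (2 * M.ρ))

/-- The Gaussian mixture of the likelihoods of the data. -/
def mixture (M : Model P) {κ : Type*} [Fintype κ] (b : P.Point × Fin (q + 1) → κ → ℝ)
    (D : List P.Datum) : ENNReal :=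
  (∫⁻ x : κ → ℝ, ENNReal.ofReal (Real.exp ((D.map (logWeight M b x)).sum - (x ⬝ᵥ x) / 2))) /
    gaussMass κ

lemma sum_get {α β : Type*} [AddCommMonoid β] (l : List α) (f : α → β) :
    ∑ j : Fin l.length, f (l.get j) = (l.map f).sum := by
  simp

/-- The quantized locations of the measurements. -/
def locQ (D : List P.Datum) (j : Fin D.length × Fin (q + 1)) : P.Point × Fin (q + 1) :=
  ((D.get j.1).1, j.2)

/-- The noise vector of the measurements. -/
def residVec (D : List P.Datum) (j : Fin D.length × Fin (q + 1)) : ℝ := resid (D.get j.1) j.2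

variable {M : Model P} {κ : Type*} [Fintype κ] [DecidableEq κ]
  {b : P.Point × Fin (q + 1) → κ → ℝ} (hb : IsFeature M b)

include hb in
-- In the weights, the log-likelihood is linear minus quadratic, so the mixture is a Gaussian
-- Laplace transform. The vector `β` plays the role of `(K + ρ I)⁻¹` applied to the noise.
lemma mixture_eq (hρ : 0 < M.ρ) (hσ : 0 < M.σ) (D : List P.Datum) {β : _ → ℝ}
    (hβ : M.gram (Model.loc D) *ᵥ β + M.ρ • β = residVec D) :
    mixture M b D = ENNReal.ofReal
      (Real.exp (M.gram (Model.loc D) *ᵥ β ⬝ᵥ residVec D / (2 * M.σ ^ 2)) /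
        √(infoMat M b (locQ D)).det) := by
  set Φ : Matrix (Fin D.length × Fin (q + 1)) κ ℝ := Matrix.of fun j => b (locQ D j) with hΦ
  have hK : M.gram (Model.loc D) = Φ * Φᵀ := gram_eq_feature hb (locQ D)
  rw [hK] at hβ ⊢
  -- With this scale the sub-Gaussian compensator is `(b ⬝ᵥ x) ^ 2 / (2 * ρ)`, so the mixture
  -- produces the information matrix for the model variance `ρ` although the true noise has constant
  -- `σ`.
  set s := (√M.ρ * M.σ)⁻¹ with hs
  set r := residVec D
  have hexp : ∀ x : κ → ℝ, (D.map (logWeight M b x)).sum - (x ⬝ᵥ x) / 2 =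
      (s • Φᵀ *ᵥ r) ⬝ᵥ x - (x ⬝ᵥ infoMat M b (locQ D) *ᵥ x) / 2 := by
    intro x
    have h1 : (D.map (logWeight M b x)).sum =
        ∑ j : Fin D.length × Fin (q + 1),
          (s * (b (locQ D j) ⬝ᵥ x) * r j - (b (locQ D j) ⬝ᵥ x) ^ 2 / (2 * M.ρ)) := by
      rw [← sum_get, Fintype.sum_prod_type]
      rfl
    have h2 : (s • Φᵀ *ᵥ r) ⬝ᵥ x = ∑ j, s * (b (locQ D j) ⬝ᵥ x) * r j := by
      rw [smul_dotProduct, mulVec_transpose, ← dotProduct_mulVec, smul_eq_mul, dotProduct,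
        Finset.mul_sum]
      refine Finset.sum_congr rfl fun j _ => ?_
      change s * (r j * (b (locQ D j) ⬝ᵥ x)) = _
      ring
    rw [h1, h2, quadratic_infoMat, Finset.sum_sub_distrib, Finset.mul_sum]
    have h3 : ∑ j, (b (locQ D j) ⬝ᵥ x) ^ 2 / (2 * M.ρ) =
        (∑ j, M.ρ⁻¹ * (b (locQ D j) ⬝ᵥ x) ^ 2) / 2 := by
      rw [Finset.sum_div]
      refine Finset.sum_congr rfl fun j _ => ?_
      field_simp
    rw [h3]
    ring
  -- The centre of the Gaussian, by the push-through identity `(ρ I + Φᵀ Φ) Φᵀ = Φᵀ (ρ I + Φ Φᵀ)`.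
  have hc : infoMat M b (locQ D) *ᵥ ((s * M.ρ) • Φᵀ *ᵥ β) = s • Φᵀ *ᵥ r := by
    rw [mulVec_smul, ← hβ, infoMat, add_mulVec, one_mulVec, smul_mulVec, mulVec_add, mulVec_smul,
      mul_smul, ← mulVec_mulVec, ← mulVec_mulVec, smul_add, smul_add, smul_add, add_comm]
    congr 1
    rw [smul_smul, smul_smul, mul_assoc, mul_inv_cancel₀ hρ.ne', mul_one]
  simp only [mixture, hexp]
  rw [lintegral_gaussian (posDef_infoMat hρ _) hc,
    ENNReal.mul_div_cancel_right gaussMass_ne_zero gaussMass_ne_top]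
  congr 3
  rw [smul_dotProduct, dotProduct_smul, smul_eq_mul, smul_eq_mul]
  have h4 : Φᵀ *ᵥ r ⬝ᵥ Φᵀ *ᵥ β = (Φ * Φᵀ) *ᵥ β ⬝ᵥ r := by
    rw [mulVec_transpose, ← dotProduct_mulVec, mulVec_mulVec, dotProduct_comm]
  rw [h4]
  have h5 : s * (s * M.ρ) = 1 / M.σ ^ 2 := by
    have : s * s = 1 / (M.ρ * M.σ ^ 2) := by
      rw [hs, ← mul_inv, ← Real.mul_self_sqrt hρ.le]
      have : √M.ρ ≠ 0 := (Real.sqrt_pos.2 hρ).ne'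
      have h0 : √(√M.ρ * √M.ρ) = √M.ρ := by rw [Real.mul_self_sqrt hρ.le]
      rw [h0]
      field_simp
    rw [← mul_assoc, this]
    field_simp
  calc s * (s * M.ρ * ((Φ * Φᵀ) *ᵥ β ⬝ᵥ r)) / 2 = s * (s * M.ρ) * ((Φ * Φᵀ) *ᵥ β ⬝ᵥ r) / 2 := by
        ring
    _ = 1 / M.σ ^ 2 * ((Φ * Φᵀ) *ᵥ β ⬝ᵥ r) / 2 := by rw [h5]
    _ = _ := by field_simp

include hb in
-- Taking logarithms in `mixture_eq`, half the log-determinant is at most `gamma`. The summand `1`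
-- is slack.
lemma noise_form_le_of_mixture_le (hρ : 0 < M.ρ) (hσ : 0 < M.σ) (hδ : 0 < M.δ)
    {D : List P.Datum} (h : mixture M b D ≤ ENNReal.ofReal (1 / M.δ)) {N : ℕ}
    [Nonempty P.Point] (hN : D.length ≤ N) {β : _ → ℝ}
    (hβ : M.gram (Model.loc D) *ᵥ β + M.ρ • β = residVec D) :
    M.gram (Model.loc D) *ᵥ β ⬝ᵥ residVec D ≤
      2 * M.σ ^ 2 * (M.gamma (N * (q + 1)) + 1 + Real.log (1 / M.δ)) := by
  rw [mixture_eq hb hρ hσ D hβ, ENNReal.ofReal_le_ofReal_iff (by positivity)] at h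
  have hdet := (posDef_infoMat (b := b) hρ (locQ D)).det_pos
  have hγ := log_det_le_gamma hb hρ (locQ D) (N := N * (q + 1))
    (by simpa using Nat.mul_le_mul_right (q + 1) hN)
  have h1 := Real.log_le_log (by positivity) h
  rw [Real.log_div (Real.exp_pos _).ne' (Real.sqrt_pos.2 hdet).ne', Real.log_exp,
    Real.log_sqrt hdet.le] at h1
  have h2 : M.gram (Model.loc D) *ᵥ β ⬝ᵥ residVec D / (2 * M.σ ^ 2) ≤
      M.gamma (N * (q + 1)) + 1 + Real.log (1 / M.δ) := by linarith
  rwa [div_le_iff₀ (by positivity), mul_comm] at h2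

/-! ### Posterior mean and variance -/

variable {H : Type*} [NormedAddCommGroup H] [InnerProductSpace ℝ H] {φ : P.Dom → H}
  (hk : ∀ u v, M.k u v = inner ℝ (φ u) (φ v))

include hk in
-- The mean is linear in the observations, which are true values plus residuals. The error therefore
-- splits into the bias of noiseless regression and a linear noise term.
lemma mean_sub (hρ : 0 < M.ρ) {F : H} (hF : ∀ a x i, inner ℝ (φ (a, x, i)) F = P.h a x i)
    (D : List P.Datum) (z : P.Dom) :
    inner ℝ (φ z) F - M.mean D z = (inner ℝ (φ z) F -
      ∑ j, ((M.gram (Model.loc D) + M.ρ • 1)⁻¹ *ᵥ fun j => M.k z (Model.loc D j)) j *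
        inner ℝ (φ (Model.loc D j)) F) -
      ((M.gram (Model.loc D) + M.ρ • 1)⁻¹ *ᵥ fun j => M.k z (Model.loc D j)) ⬝ᵥ
        residVec D := by
  have hsymm : (M.gram (Model.loc D) + M.ρ • 1)⁻¹ᵀ = (M.gram (Model.loc D) + M.ρ • 1)⁻¹ := by
    have := (posDef_gram_add (K := M.gram (Model.loc D)) (φ := fun j => φ (Model.loc D j))
      (fun i j => hk _ _) hρ).isHermitian
    rw [transpose_nonsing_inv]
    rw [IsHermitian, conjTranspose_eq_transpose_of_trivial] at this
    rw [this]
  have hobs : Model.obs D = (fun j => inner ℝ (φ (Model.loc D j)) F) + residVec D := by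
    ext j
    rw [Pi.add_apply, Model.loc, Problem.toDom, hF, residVec, resid, Model.obs]
    ring
  rw [Model.mean, dotProduct_mulVec, ← mulVec_transpose, hsymm, hobs, dotProduct_add]
  simp only [dotProduct]
  ring

include hk in
/-- The confidence interval contains the true value if the noise is under control. -/
lemma mem_Q_of_noise_form_le (hρ : 1 / 8 ≤ M.ρ) (hσ : 0 ≤ M.σ) {F : H}
    (hF : ∀ a x i, inner ℝ (φ (a, x, i)) F = P.h a x i) (hB : ‖F‖ ≤ M.B) {n : ℕ}
    {D : List P.Datum}
    (hΓ : 0 ≤ M.gamma (n * (q + 1)) + 1 + Real.log (1 / M.δ))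
    (hnoise : ∀ β : _ → ℝ, M.gram (Model.loc D) *ᵥ β + M.ρ • β = residVec D →
      M.gram (Model.loc D) *ᵥ β ⬝ᵥ residVec D ≤
        2 * M.σ ^ 2 * (M.gamma (n * (q + 1)) + 1 + Real.log (1 / M.δ)))
    (p : P.Point) (i : Fin (q + 1)) : P.h p.1 p.2 i ∈ M.Q (n + 1) D p i := by
  have hρ0 : 0 < M.ρ := by linarith
  set z := P.toDom p i
  set Γ := M.gamma (n * (q + 1)) + 1 + Real.log (1 / M.δ)
  have hz : inner ℝ (φ z) F = P.h p.1 p.2 i := hF _ _ _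
  have hK : ∀ i j, M.gram (Model.loc D) i j =
      inner ℝ (φ (Model.loc D i)) (φ (Model.loc D j)) := fun i j => hk _ _
  have hc : ∀ j, M.k z (Model.loc D j) = inner ℝ (φ z) (φ (Model.loc D j)) := fun j => hk _ _
  have hvar : M.var D z = inner ℝ (φ z) (φ z) - (fun j => M.k z (Model.loc D j)) ⬝ᵥ
      (M.gram (Model.loc D) + M.ρ • 1)⁻¹ *ᵥ (fun j => M.k z (Model.loc D j)) := by
    rw [Model.var, hk]
  have hV : 0 ≤ M.var D z := by rw [hvar]; exact variance_nonneg hK hρ0 hc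
  have h1 := abs_inner_sub_le hK hρ0 hc F
  have h2 := sq_noise_le hK hρ0 hc (residVec D)
  rw [← hvar] at h1 h2
  have hβ : M.gram (Model.loc D) *ᵥ ((M.gram (Model.loc D) + M.ρ • 1)⁻¹ *ᵥ residVec D) +
      M.ρ • ((M.gram (Model.loc D) + M.ρ • 1)⁻¹ *ᵥ residVec D) = residVec D := by
    have := mulVec_inv_mulVec hK hρ0 (residVec D)
    rwa [add_mulVec, smul_mulVec, one_mulVec] at this
  have h3 := hnoise _ hβ
  have hm := mean_sub hk hρ0 hF D z
  rw [hz] at hm h1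
  set u := ((M.gram (Model.loc D) + M.ρ • 1)⁻¹ *ᵥ fun j => M.k z (Model.loc D j)) ⬝ᵥ residVec D
  set w := ∑ j, ((M.gram (Model.loc D) + M.ρ • 1)⁻¹ *ᵥ fun j => M.k z (Model.loc D j)) j *
        inner ℝ (φ (Model.loc D j)) F
  have h4 : |u| ≤ 4 * M.σ * √Γ * M.sd D z := by
    refine abs_le_of_sq_le_sq ?_ (by unfold Model.sd; positivity)
    refine h2.trans ?_
    have hsd : M.sd D z ^ 2 = M.var D z := Real.sq_sqrt hV
    have hsΓ : √Γ ^ 2 = Γ := Real.sq_sqrt hΓ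
    -- Here `ρ ≥ 1 / 8` enters: it turns `2 * σ ^ 2 / ρ` into at most `16 * σ ^ 2`, the square of
    -- the factor `4 * σ` in `sqrtBeta`.
    have h5 : M.var D z / M.ρ ≤ 8 * M.var D z := by
      rw [div_le_iff₀ hρ0]
      nlinarith
    calc _ ≤ M.var D z / M.ρ * (2 * M.σ ^ 2 * Γ) :=
          mul_le_mul_of_nonneg_left h3 (by positivity)
      _ ≤ 8 * M.var D z * (2 * M.σ ^ 2 * Γ) := mul_le_mul_of_nonneg_right h5 (by positivity)
      _ = (4 * M.σ * √Γ * M.sd D z) ^ 2 := by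
          rw [mul_pow, hsd, mul_pow, hsΓ]
          ring
  have h6 : ‖F‖ * √(M.var D z) ≤ M.B * M.sd D z :=
    mul_le_mul_of_nonneg_right hB (Real.sqrt_nonneg _)
  have h7 : M.sqrtBeta (n + 1) * M.sd D z = M.B * M.sd D z + 4 * M.σ * √Γ * M.sd D z := by
    simp only [Model.sqrtBeta, Nat.add_sub_cancel, Γ]
    ring
  obtain ⟨h8, h9⟩ := abs_le.1 (h1.trans h6)
  obtain ⟨h10, h11⟩ := abs_le.1 h4
  constructor
  · change M.mean D z - M.sqrtBeta (n + 1) * M.sd D z ≤ _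
    linarith
  · change _ ≤ M.mean D z + M.sqrtBeta (n + 1) * M.sd D z
    linarith

include hk in
/-- The posterior variance at a point measured `k` times is at most `ρ / k`. -/
lemma var_le (hρ : 0 < M.ρ) (D : List P.Datum) (p : P.Point) (i : Fin (q + 1)) {k : ℕ}
    (hk1 : 1 ≤ k) [DecidablePred fun j : Fin D.length => (D.get j).1 = p]
    (hkD : (Finset.univ.filter fun j : Fin D.length => (D.get j).1 = p).card = k) :
    M.var D (P.toDom p i) ≤ M.ρ / k := by
  classical
  set z := P.toDom p i
  have hk0 : (k : ℝ) ≠ 0 := by positivity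
  have hK : ∀ i j, M.gram (Model.loc D) i j =
      inner ℝ (φ (Model.loc D i)) (φ (Model.loc D j)) := fun i j => hk _ _
  have hc : ∀ j, M.k z (Model.loc D j) = inner ℝ (φ z) (φ (Model.loc D j)) := fun j => hk _ _
  have hvar : M.var D z = inner ℝ (φ z) (φ z) - (fun j => M.k z (Model.loc D j)) ⬝ᵥ
      (M.gram (Model.loc D) + M.ρ • 1)⁻¹ *ᵥ (fun j => M.k z (Model.loc D j)) := by
    rw [Model.var, hk]
  rw [hvar]
  -- Test vector: weight `1 / k` on each of the `k` measurements of this very value. It reproduces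
  -- `φ z` exactly, so only the penalty `ρ * k * (1 / k) ^ 2` remains.
  refine (variance_le hK hρ hc
    (fun j => if (D.get j.1).1 = p ∧ j.2 = i then (k : ℝ)⁻¹ else 0)).trans ?_
  have h1 : ∑ j : Fin D.length × Fin (q + 1),
      (if (D.get j.1).1 = p ∧ j.2 = i then (k : ℝ)⁻¹ else 0) • φ (Model.loc D j) = φ z := by
    rw [Fintype.sum_prod_type]
    have h2 : ∀ j : Fin D.length, ∑ i' : Fin (q + 1),
        (if (D.get j).1 = p ∧ i' = i then (k : ℝ)⁻¹ else 0) • φ (Model.loc D (j, i')) =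
        if (D.get j).1 = p then (k : ℝ)⁻¹ • φ z else 0 := by
      intro j
      split_ifs with h
      · rw [Finset.sum_eq_single i]
        · simp only [h, Model.loc, true_and, if_true, z]
        · intro i' _ hi'
          simp [hi']
        · simp
      · simp only [h, false_and, if_false, zero_smul, Finset.sum_const_zero]
    simp only [h2]
    rw [← Finset.sum_filter, Finset.sum_const, hkD, ← Nat.cast_smul_eq_nsmul ℝ, smul_smul,
      mul_inv_cancel₀ hk0, one_smul]
  have h3 : (fun j : Fin D.length × Fin (q + 1) =>
      if (D.get j.1).1 = p ∧ j.2 = i then (k : ℝ)⁻¹ else 0) ⬝ᵥ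
      (fun j => if (D.get j.1).1 = p ∧ j.2 = i then (k : ℝ)⁻¹ else 0) = (k : ℝ)⁻¹ := by
    rw [dotProduct, Fintype.sum_prod_type]
    have h2 : ∀ j : Fin D.length, ∑ i' : Fin (q + 1),
        (if (D.get j).1 = p ∧ i' = i then (k : ℝ)⁻¹ else 0) *
          (if (D.get j).1 = p ∧ i' = i then (k : ℝ)⁻¹ else 0) =
        if (D.get j).1 = p then (k : ℝ)⁻¹ * (k : ℝ)⁻¹ else 0 := by
      intro j
      split_ifs with h
      · simp only [h, true_and, mul_ite, ite_mul, zero_mul, mul_zero]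
        rw [Finset.sum_eq_single i]
        · simp
        · intro i' _ hi'
          simp [hi']
        · simp
      · simp only [h, false_and, if_false, mul_zero, Finset.sum_const_zero]
    simp only [h2]
    rw [← Finset.sum_filter, Finset.sum_const, hkD, nsmul_eq_mul, ← mul_assoc,
      mul_inv_cancel₀ hk0, one_mul]
  rw [h1, h3, sub_self, norm_zero]
  simp [div_eq_mul_inv]

end Confidence

section Noise

variable {q : ℕ} {Ω : Type*} {mΩ : MeasurableSpace Ω} {ℙ : Measure Ω}
  {ℱ : Filtration ℕ mΩ} {σ : ℝ} {v : ℕ → Ω → Fin (q + 1) → ℝ}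

/-! ### Sub-Gaussian noise -/

lemma setLIntegral_exp_le [IsProbabilityMeasure ℙ] (hv : SubGaussianNoise ℙ ℱ σ v) (n : ℕ)
    (c : Fin (q + 1) → ℝ) {s : Set Ω} (hs : MeasurableSet[ℱ n] s) :
    ∫⁻ ω in s, ENNReal.ofReal (Real.exp (∑ i, c i * v n ω i)) ∂ℙ ≤
      ENNReal.ofReal (Real.exp (σ ^ 2 * (∑ i, c i ^ 2) / 2)) * ℙ s := by
  obtain ⟨hint, hce⟩ := hv.2 n c
  have hs' : MeasurableSet s := ℱ.le n s hs
  rw [← ofReal_integral_eq_lintegral_ofReal hint.integrableOn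
    (ae_of_all _ fun _ => (Real.exp_pos _).le), ← setIntegral_condExp (ℱ.le n) hint hs]
  have h1 : ∫ ω in s, (ℙ[fun ω => Real.exp (∑ i, c i * v n ω i) | ℱ n]) ω ∂ℙ ≤
      ∫ _ in s, Real.exp (σ ^ 2 * (∑ i, c i ^ 2) / 2) ∂ℙ :=
    setIntegral_mono_ae integrable_condExp.integrableOn (integrable_const _).integrableOn hce
  refine (ENNReal.ofReal_le_ofReal h1).trans ?_
  rw [setIntegral_const, smul_eq_mul, mul_comm, ENNReal.ofReal_mul (Real.exp_pos _).le,
    Measure.real, ENNReal.ofReal_toReal (measure_ne_top _ _)]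

/-- The conditional moment generating function bound, tested against functions of the past. -/
lemma lintegral_mul_exp_le [IsProbabilityMeasure ℙ] (hv : SubGaussianNoise ℙ ℱ σ v) (n : ℕ)
    (c : Fin (q + 1) → ℝ) {X : Ω → ENNReal} (hX : Measurable[ℱ n] X) :
    ∫⁻ ω, X ω * ENNReal.ofReal (Real.exp (∑ i, c i * v n ω i)) ∂ℙ ≤
      ∫⁻ ω, X ω * ENNReal.ofReal (Real.exp (σ ^ 2 * (∑ i, c i ^ 2) / 2)) ∂ℙ := by
  set Z : Ω → ENNReal := fun ω => ENNReal.ofReal (Real.exp (∑ i, c i * v n ω i)) with hZ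
  set C : ENNReal := ENNReal.ofReal (Real.exp (σ ^ 2 * (∑ i, c i ^ 2) / 2))
  have hvm : ∀ i, Measurable fun ω => v n ω i := fun i => (hv.1 n i).mono (ℱ.le _) le_rfl
  have hZm : Measurable Z := by fun_prop
  have hX' : Measurable X := hX.mono (ℱ.le n) le_rfl
  -- The bound on all events of the past is a comparison of two measures on `ℱ n`; integrating `X`
  -- against both gives the claim.
  have hle : (ℙ.withDensity Z).trim (ℱ.le n) ≤ (C • ℙ).trim (ℱ.le n) := by
    refine Measure.le_iff.2 fun s hs => ?_
    rw [trim_measurableSet_eq _ hs, trim_measurableSet_eq _ hs,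
      withDensity_apply _ (ℱ.le n s hs), Measure.smul_apply, smul_eq_mul]
    exact setLIntegral_exp_le hv n c hs
  calc ∫⁻ ω, X ω * Z ω ∂ℙ = ∫⁻ ω, X ω ∂(ℙ.withDensity Z) := by
        rw [lintegral_withDensity_eq_lintegral_mul _ hZm hX']
        simp only [Pi.mul_apply, mul_comm]
    _ = ∫⁻ ω, X ω ∂((ℙ.withDensity Z).trim (ℱ.le n)) := (lintegral_trim _ hX).symm
    _ ≤ ∫⁻ ω, X ω ∂((C • ℙ).trim (ℱ.le n)) := lintegral_mono' hle le_rfl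
    _ = ∫⁻ ω, X ω ∂(C • ℙ) := lintegral_trim _ hX
    _ = ∫⁻ ω, X ω * C ∂ℙ := by
        rw [lintegral_smul_measure, lintegral_mul_const _ hX', smul_eq_mul, mul_comm]

/-- Noise with sub-Gaussian constant `0` vanishes. -/
lemma noise_ae_eq_zero [IsProbabilityMeasure ℙ] (hv : SubGaussianNoise ℙ ℱ 0 v) :
    ∀ᵐ ω ∂ℙ, ∀ n i, v n ω i = 0 := by
  classical
  rw [ae_all_iff]
  intro n
  rw [ae_all_iff]
  intro i
  have key : ∀ t : ℝ, Integrable (fun ω => Real.exp (t * v n ω i)) ℙ ∧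
      ∫ ω, Real.exp (t * v n ω i) ∂ℙ ≤ 1 := by
    intro t
    obtain ⟨hint, hce⟩ := hv.2 n (Pi.single i t)
    have hsum : ∀ ω, ∑ j, (Pi.single i t : Fin (q + 1) → ℝ) j * v n ω j = t * v n ω i := by
      intro ω
      rw [Finset.sum_eq_single i]
      · simp
      · intro j _ hj
        simp [Pi.single_eq_of_ne hj]
      · simp
    simp only [hsum] at hint hce
    refine ⟨hint, ?_⟩
    rw [← integral_condExp (ℱ.le n)]
    refine (integral_mono_ae integrable_condExp (integrable_const _) hce).trans ?_
    simp
  -- The exponential moments at `1` and `-1` are each at most `1`, whereas `2 * cosh ≥ 2` with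
  -- equality only at `0`.
  obtain ⟨h1, h1'⟩ := key 1
  obtain ⟨h2, h2'⟩ := key (-1)
  have hnn : ∀ ω, 0 ≤ Real.exp (1 * v n ω i) + Real.exp (-1 * v n ω i) - 2 := by
    intro ω
    have := Real.one_le_cosh (v n ω i)
    rw [Real.cosh_eq] at this
    simp only [one_mul, neg_mul]
    linarith
  have h12 : Integrable (fun ω => Real.exp (1 * v n ω i) + Real.exp (-1 * v n ω i)) ℙ := h1.add h2
  have hz : ∫ ω, (Real.exp (1 * v n ω i) + Real.exp (-1 * v n ω i) - 2) ∂ℙ = 0 := by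
    refine le_antisymm ?_ (integral_nonneg hnn)
    rw [integral_sub h12 (integrable_const _), integral_add h1 h2]
    simp only [integral_const, probReal_univ, one_smul]
    linarith
  rw [integral_eq_zero_iff_of_nonneg hnn (h12.sub (integrable_const _))] at hz
  filter_upwards [hz] with ω hω
  by_contra hne
  have := Real.one_lt_cosh.2 hne
  rw [Real.cosh_eq] at this
  simp only [Pi.zero_apply, one_mul, neg_mul] at hω
  linarith

/-! ### A maximal inequality -/

/-- Ville's inequality. -/
lemma measure_exists_lt_le [IsProbabilityMeasure ℙ] {W : ℕ → Ω → ENNReal}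
    (hW : ∀ n, Measurable[ℱ n] (W n)) (h0 : ∫⁻ ω, W 0 ω ∂ℙ ≤ 1)
    (hstep : ∀ n (s : Set Ω), MeasurableSet[ℱ n] s →
      ∫⁻ ω in s, W (n + 1) ω ∂ℙ ≤ ∫⁻ ω in s, W n ω ∂ℙ)
    {δ : ℝ} (hδ : 0 < δ) :
    ℙ {ω | ∃ n, ENNReal.ofReal (1 / δ) < W n ω} ≤ ENNReal.ofReal δ := by
  set K := ENNReal.ofReal (1 / δ) with hK
  set A : ℕ → Set Ω := fun n => {ω | ∀ j ≤ n, W j ω ≤ K} with hA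
  have hWm : ∀ n, Measurable (W n) := fun n => (hW n).mono (ℱ.le n) le_rfl
  have hsucc : ∀ n, A (n + 1) = A n ∩ {ω | W (n + 1) ω ≤ K} := by
    intro n
    ext ω
    constructor
    · exact fun h => ⟨fun j hj => h j (by omega), h (n + 1) le_rfl⟩
    · rintro ⟨h1, h2⟩ j hj
      rcases Nat.le_succ_iff.1 hj with h | rfl
      · exact h1 j h
      · exact h2
  have hAm : ∀ n, MeasurableSet[ℱ n] (A n) := by
    intro n
    have : A n = ⋂ j, ⋂ (_ : j ≤ n), {ω | W j ω ≤ K} := by ext ω; simp [A]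
    rw [this]
    refine MeasurableSet.iInter fun j => MeasurableSet.iInter fun hj => ?_
    exact measurableSet_le ((hW j).mono (ℱ.mono hj) le_rfl) measurable_const
  have hlow : ∀ (n : ℕ) (s : Set Ω), MeasurableSet s → (∀ ω ∈ s, K ≤ W n ω) →
      K * ℙ s ≤ ∫⁻ ω in s, W n ω ∂ℙ := by
    intro n s hs h
    rw [← setLIntegral_const]
    exact setLIntegral_mono (hWm n) h
  -- The left side is the expectation of the process frozen at the value `K` once it has exceeded
  -- `K`. It does not increase, because `A n` belongs to the past `ℱ n` and the overshoot is
  -- discarded.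
  have main : ∀ n, ∫⁻ ω in A n, W n ω ∂ℙ + K * ℙ (A n)ᶜ ≤ 1 := by
    intro n
    induction n with
    | zero =>
      have hm := ℱ.le 0 _ (hAm 0)
      refine le_trans ?_ ((lintegral_add_compl (W 0) hm).le.trans h0)
      refine add_le_add_right (hlow 0 _ hm.compl fun ω hω => ?_) _
      simp only [A, mem_compl_iff, mem_ofPred_eq, Nat.le_zero, forall_eq, not_le] at hω
      exact hω.le
    | succ n ih =>
      have hm := ℱ.le n _ (hAm n)
      have hCm : MeasurableSet {ω | W (n + 1) ω ≤ K} := measurableSet_le (hWm _) measurable_const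
      have hcompl : (A (n + 1))ᶜ = (A n)ᶜ ∪ A n \ {ω | W (n + 1) ω ≤ K} := by
        rw [hsucc]
        ext ω
        simp only [mem_compl_iff, mem_inter_iff, mem_union, mem_sdiff]
        tauto
      have h1 : K * ℙ (A n \ {ω | W (n + 1) ω ≤ K}) ≤
          ∫⁻ ω in A n \ {ω | W (n + 1) ω ≤ K}, W (n + 1) ω ∂ℙ :=
        hlow (n + 1) _ (hm.diff hCm) fun ω hω => (not_le.1 hω.2).le
      calc ∫⁻ ω in A (n + 1), W (n + 1) ω ∂ℙ + K * ℙ (A (n + 1))ᶜ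
          ≤ ∫⁻ ω in A n ∩ {ω | W (n + 1) ω ≤ K}, W (n + 1) ω ∂ℙ +
            (K * ℙ (A n)ᶜ + ∫⁻ ω in A n \ {ω | W (n + 1) ω ≤ K}, W (n + 1) ω ∂ℙ) := by
            rw [hcompl, ← hsucc]
            gcongr
            refine (mul_le_mul_right (measure_union_le _ _) K).trans ?_
            rw [mul_add]
            gcongr
        _ = ∫⁻ ω in A n, W (n + 1) ω ∂ℙ + K * ℙ (A n)ᶜ := by
            rw [add_comm (K * ℙ (A n)ᶜ), ← add_assoc, lintegral_inter_add_sdiff _ _ hCm]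
        _ ≤ ∫⁻ ω in A n, W n ω ∂ℙ + K * ℙ (A n)ᶜ := by
            exact add_le_add (hstep n _ (hAm n)) le_rfl
        _ ≤ 1 := ih
  have hbound : ∀ n, ℙ (A n)ᶜ ≤ ENNReal.ofReal δ := by
    intro n
    have h1 : K * ℙ (A n)ᶜ ≤ 1 := le_add_self.trans (main n)
    have h2 : ENNReal.ofReal δ * K = 1 := by
      rw [hK, ← ENNReal.ofReal_mul hδ.le, mul_one_div_cancel hδ.ne', ENNReal.ofReal_one]
    calc ℙ (A n)ᶜ = ENNReal.ofReal δ * (K * ℙ (A n)ᶜ) := by rw [← mul_assoc, h2, one_mul]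
      _ ≤ ENNReal.ofReal δ * 1 := by gcongr
      _ = ENNReal.ofReal δ := mul_one _
  have hunion : {ω | ∃ n, K < W n ω} = ⋃ n, (A n)ᶜ := by
    ext ω
    simp only [mem_ofPred_eq, mem_iUnion, mem_compl_iff, A, not_forall, not_le]
    exact ⟨fun ⟨n, h⟩ => ⟨n, n, le_rfl, h⟩, fun ⟨n, j, _, h⟩ => ⟨j, h⟩⟩
  have hmono : Monotone fun n => (A n)ᶜ := by
    intro n k hnk
    refine compl_subset_compl.2 fun ω h j hj => h j (hj.trans hnk)
  rw [hunion, hmono.measure_iUnion]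
  exact iSup_le hbound

/-! ### The mixture martingale -/

variable {κ : Type*} {O : Type*} [MeasurableSpace O] [DiscreteMeasurableSpace O]
  [Fintype O]

/-- The logarithm of the exponential process with weights `c (pt j) x`. -/
def logProcess (σ : ℝ) (c : O → (κ → ℝ) → Fin (q + 1) → ℝ) (pt : ℕ → Ω → O)
    (v : ℕ → Ω → Fin (q + 1) → ℝ) (n : ℕ) (ω : Ω) (x : κ → ℝ) : ℝ :=
  ∑ j ∈ Finset.range n, (∑ i, c (pt j ω) x i * v j ω i -
    σ ^ 2 * (∑ i, c (pt j ω) x i ^ 2) / 2)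

lemma measurable_logProcess {mΩ' : MeasurableSpace Ω} {c : O → (κ → ℝ) → Fin (q + 1) → ℝ}
    (hc : ∀ o i, Measurable fun x => c o x i) {pt : ℕ → Ω → O} {n : ℕ}
    (hpt : ∀ j < n, Measurable (pt j)) (hv : ∀ j < n, ∀ i, Measurable fun ω => v j ω i) :
    Measurable fun z : Ω × (κ → ℝ) => logProcess σ c pt v n z.1 z.2 := by
  unfold logProcess
  refine Finset.measurable_fun_sum _ fun j hj => ?_
  have hj' := Finset.mem_range.1 hj
  have h1 : ∀ i, Measurable fun z : Ω × (κ → ℝ) => c (pt j z.1) z.2 i := by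
    intro i
    have h2 : Measurable fun y : O × (κ → ℝ) => c y.1 y.2 i :=
      measurable_from_prod_countable_right fun o => hc o i
    exact h2.comp (((hpt j hj').comp measurable_fst).prodMk measurable_snd)
  have h3 : ∀ i, Measurable fun z : Ω × (κ → ℝ) => v j z.1 i := fun i =>
    (hv j hj' i).comp measurable_fst
  exact (Finset.measurable_fun_sum _ fun i _ => (h1 i).mul (h3 i)).sub
    (((Finset.measurable_fun_sum _ fun i _ => (h1 i).pow_const 2).const_mul _).div_const _)

omit [Fintype O] in
lemma measurable_logProcess_left {mΩ' : MeasurableSpace Ω} {c : O → (κ → ℝ) → Fin (q + 1) → ℝ}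
    {pt : ℕ → Ω → O} {n : ℕ}
    (hpt : ∀ j < n, Measurable (pt j)) (hv : ∀ j < n, ∀ i, Measurable fun ω => v j ω i)
    (x : κ → ℝ) : Measurable fun ω => logProcess σ c pt v n ω x :=
  Finset.measurable_fun_sum _ fun j hj => by
    have hj' := Finset.mem_range.1 hj
    have h1 : ∀ i, Measurable fun ω => c (pt j ω) x i := fun i =>
      (Measurable.of_discrete (f := fun o => c o x i)).comp (hpt j hj')
    exact (Finset.measurable_fun_sum _ fun i _ => (h1 i).mul (hv j hj' i)).sub
      (((Finset.measurable_fun_sum _ fun i _ => (h1 i).pow_const 2).const_mul _).div_const _)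


/-- The exponential process, mixed over the weights. -/
def mixProcess (ν : Measure (κ → ℝ)) (σ : ℝ) (c : O → (κ → ℝ) → Fin (q + 1) → ℝ)
    (pt : ℕ → Ω → O) (v : ℕ → Ω → Fin (q + 1) → ℝ) (n : ℕ) (ω : Ω) : ENNReal :=
  ∫⁻ x, ENNReal.ofReal (Real.exp (logProcess σ c pt v n ω x)) ∂ν

variable {ν : Measure (κ → ℝ)} [SFinite ν] {c : O → (κ → ℝ) → Fin (q + 1) → ℝ}
  (hc : ∀ o i, Measurable fun x => c o x i) {pt : ℕ → Ω → O}
  (hpt : ∀ n, Measurable[ℱ n] (pt n))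

lemma measurable_mixProcess_of_measurable {mΩ' : MeasurableSpace Ω}
    (hc : ∀ o i, Measurable fun x => c o x i) {n : ℕ}
    (hpt : ∀ j < n, Measurable (pt j)) (hv : ∀ j < n, ∀ i, Measurable fun ω => v j ω i) :
    Measurable (mixProcess ν σ c pt v n) :=
  Measurable.lintegral_prod_right'
    (f := fun z : Ω × (κ → ℝ) => ENNReal.ofReal (Real.exp (logProcess σ c pt v n z.1 z.2)))
    (Real.measurable_exp.comp (measurable_logProcess hc hpt hv)).ennreal_ofReal

include hc hpt in
lemma measurable_mixProcess (hv : SubGaussianNoise ℙ ℱ σ v) (n : ℕ) :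
    Measurable[ℱ n] (mixProcess ν σ c pt v n) :=
  measurable_mixProcess_of_measurable (mΩ' := ℱ n) hc (fun j hj => (hpt j).mono (ℱ.mono hj.le) le_rfl)
    (fun j hj i => (hv.1 j i).mono (ℱ.mono hj) le_rfl)

include hpt in
-- For fixed weights the exponential process is a supermartingale. The moment bound holds for
-- deterministic vectors, while the measured point is random; it is known at time `n` and takes
-- finitely many values, so the event is split according to it.
lemma setLIntegral_logProcess_succ_le [IsProbabilityMeasure ℙ] (hv : SubGaussianNoise ℙ ℱ σ v)
    (n : ℕ) {s : Set Ω} (hs : MeasurableSet[ℱ n] s) (x : κ → ℝ) :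
    ∫⁻ ω in s, ENNReal.ofReal (Real.exp (logProcess σ c pt v (n + 1) ω x)) ∂ℙ ≤
      ∫⁻ ω in s, ENNReal.ofReal (Real.exp (logProcess σ c pt v n ω x)) ∂ℙ := by
  classical
  have hL : Measurable[ℱ n] fun ω => logProcess σ c pt v n ω x :=
    measurable_logProcess_left (mΩ' := ℱ n)
      (fun j hj => (hpt j).mono (ℱ.mono hj.le) le_rfl)
      (fun j hj i => (hv.1 j i).mono (ℱ.mono hj) le_rfl) x
  set C : O → ENNReal := fun o => ENNReal.ofReal (Real.exp (σ ^ 2 * (∑ i, c o x i ^ 2) / 2))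
  set C' : O → ENNReal := fun o => ENNReal.ofReal (Real.exp (-(σ ^ 2 * (∑ i, c o x i ^ 2) / 2)))
  have hCC : ∀ o, C' o * C o = 1 := fun o => by
    simp only [C, C']
    rw [← ENNReal.ofReal_mul (Real.exp_pos _).le, ← Real.exp_add, neg_add_cancel, Real.exp_zero,
      ENNReal.ofReal_one]
  set T : O → Set Ω := fun o => s ∩ pt n ⁻¹' {o}
  have hT : ∀ o, MeasurableSet[ℱ n] (T o) := fun o =>
    hs.inter (hpt n (MeasurableSet.singleton o))
  set X : O → Ω → ENNReal := fun o => (T o).indicator fun ω =>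
    ENNReal.ofReal (Real.exp (logProcess σ c pt v n ω x)) * C' o
  have hX : ∀ o, Measurable[ℱ n] (X o) := fun o =>
    ((Real.measurable_exp.comp hL).ennreal_ofReal.mul_const _).indicator (hT o)
  have hvm : ∀ i, Measurable fun ω => v n ω i := fun i => (hv.1 n i).mono (ℱ.le _) le_rfl
  have hXm : ∀ o, Measurable (X o) := fun o => (hX o).mono (ℱ.le n) le_rfl
  have hs' := ℱ.le n s hs
  have e1 : ∀ ω, s.indicator
      (fun ω => ENNReal.ofReal (Real.exp (logProcess σ c pt v (n + 1) ω x))) ω =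
      ∑ o, X o ω * ENNReal.ofReal (Real.exp (∑ i, c o x i * v n ω i)) := by
    intro ω
    rw [Finset.sum_eq_single (pt n ω)]
    · by_cases hω : ω ∈ s
      · have hT' : ω ∈ T (pt n ω) := ⟨hω, rfl⟩
        simp only [X, indicator_of_mem hω, indicator_of_mem hT', C']
        rw [← ENNReal.ofReal_mul (Real.exp_pos _).le, ← Real.exp_add,
          ← ENNReal.ofReal_mul (Real.exp_pos _).le, ← Real.exp_add, logProcess,
          Finset.sum_range_succ, ← logProcess]
        congr 2
        ring
      · have hT' : ω ∉ T (pt n ω) := fun h => hω h.1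
        simp only [X, indicator_of_notMem hω, indicator_of_notMem hT', zero_mul]
    · intro o _ ho
      have hT' : ω ∉ T o := fun h => ho h.2.symm
      simp only [X, indicator_of_notMem hT', zero_mul]
    · simp
  have e2 : ∀ ω, s.indicator
      (fun ω => ENNReal.ofReal (Real.exp (logProcess σ c pt v n ω x))) ω =
      ∑ o, X o ω * C o := by
    intro ω
    rw [Finset.sum_eq_single (pt n ω)]
    · by_cases hω : ω ∈ s
      · have hT' : ω ∈ T (pt n ω) := ⟨hω, rfl⟩
        simp only [X, indicator_of_mem hω, indicator_of_mem hT', mul_assoc, hCC, mul_one]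
      · have hT' : ω ∉ T (pt n ω) := fun h => hω h.1
        simp only [X, indicator_of_notMem hω, indicator_of_notMem hT', zero_mul]
    · intro o _ ho
      have hT' : ω ∉ T o := fun h => ho h.2.symm
      simp only [X, indicator_of_notMem hT', zero_mul]
    · simp
  have hm : ∀ o ∈ Finset.univ, Measurable fun ω =>
      X o ω * ENNReal.ofReal (Real.exp (∑ i, c o x i * v n ω i)) := fun o _ =>
    (hXm o).mul (by fun_prop)
  have hm' : ∀ o ∈ Finset.univ, Measurable fun ω => X o ω * C o := fun o _ => (hXm o).mul_const _
  rw [← lintegral_indicator hs', ← lintegral_indicator hs', lintegral_congr e1,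
    lintegral_congr e2, lintegral_finsetSum _ hm, lintegral_finsetSum _ hm']
  exact Finset.sum_le_sum fun o _ => lintegral_mul_exp_le hv n (c o x) (hX o)

include hc hpt in
/-- With high probability, the mixture of the exponential processes stays bounded. -/
lemma measure_mixProcess_gt_le [IsProbabilityMeasure ℙ] (hν : ν univ ≤ 1)
    (hv : SubGaussianNoise ℙ ℱ σ v) {δ : ℝ} (hδ : 0 < δ) :
    ℙ {ω | ∃ n, ENNReal.ofReal (1 / δ) < mixProcess ν σ c pt v n ω} ≤ ENNReal.ofReal δ := by
  refine measure_exists_lt_le (fun n => measurable_mixProcess (ℙ := ℙ) hc hpt hv n) ?_ ?_ hδ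
  · simpa [mixProcess, logProcess] using hν
  · intro n s hs
    have hm : ∀ k, Measurable fun z : Ω × (κ → ℝ) =>
        ENNReal.ofReal (Real.exp (logProcess σ c pt v k z.1 z.2)) := fun k =>
      (Real.measurable_exp.comp (measurable_logProcess hc
        (fun j _ => (hpt j).mono (ℱ.le j) le_rfl)
        (fun j _ i => (hv.1 j i).mono (ℱ.le _) le_rfl))).ennreal_ofReal
    -- By Tonelli the mixture inherits the supermartingale inequality from each fixed weight vector.
    have hswap : ∀ k, ∫⁻ ω in s, mixProcess ν σ c pt v k ω ∂ℙ =
        ∫⁻ x, ∫⁻ ω in s, ENNReal.ofReal (Real.exp (logProcess σ c pt v k ω x)) ∂ℙ ∂ν := fun k =>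
      lintegral_lintegral_swap (hm k).aemeasurable
    rw [hswap, hswap]
    exact lintegral_mono fun x => setLIntegral_logProcess_succ_le hpt hv n hs x

end Noise

variable {d ℓ m q : ℕ} {P : Problem d ℓ m q}

/-! ### High-probability validity of the confidence intervals -/

/-- The point measured by an experiment. -/
def Move.completed : Move P → Option P.Point
  | .idle => none
  | .done p => some p
  | .stopped _ _ => none

section Mixture

open Matrix

variable {M : Model P} {κ : Type*} [Fintype κ] {b : P.Point × Fin (q + 1) → κ → ℝ}

/-- The weights of the noise in the exponential process. -/
def noiseWeight (M : Model P) (b : P.Point × Fin (q + 1) → κ → ℝ) :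
    Option P.Point → (κ → ℝ) → Fin (q + 1) → ℝ
  | none, _, _ => 0
  | some p, x, i => (√M.ρ * M.σ)⁻¹ * (b (p, i) ⬝ᵥ x)

lemma measurable_noiseWeight (o : Option P.Point) (i : Fin (q + 1)) :
    Measurable fun x => noiseWeight M b o x i := by
  cases o with
  | none => exact measurable_const
  | some p =>
    unfold noiseWeight dotProduct
    fun_prop

lemma sum_logWeight_after (hρ : 0 < M.ρ) (hσ : 0 < M.σ) {Ω : Type*} (move : ℕ → Ω → Move P)
    (noise : ℕ → Ω → Fin (q + 1) → ℝ) (n : ℕ) (ω : Ω) (x : κ → ℝ) :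
    ((Memory.after M (fun j => move j ω) (fun j => noise j ω) n).data.map
      (logWeight M b x)).sum =
      logProcess M.σ (noiseWeight M b) (fun j ω => (move j ω).completed) noise n ω x := by
  induction n with
  | zero => simp [Memory.after, Memory.init, logProcess]
  | succ n ih =>
    have hsucc : logProcess M.σ (noiseWeight M b) (fun j ω => (move j ω).completed) noise (n + 1)
        ω x = logProcess M.σ (noiseWeight M b) (fun j ω => (move j ω).completed) noise n ω x +
        (∑ i, noiseWeight M b (move n ω).completed x i * noise n ω i -
          M.σ ^ 2 * (∑ i, noiseWeight M b (move n ω).completed x i ^ 2) / 2) :=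
      Finset.sum_range_succ _ _
    rw [hsucc, ← ih]
    change ((Memory.nextData _ (noise n ω) (move n ω)).map (logWeight M b x)).sum = _
    cases move n ω with
    | idle => simp [Memory.nextData, Move.completed, noiseWeight]
    | stopped p r => simp [Memory.nextData, Move.completed, noiseWeight]
    | done p =>
      rw [Memory.nextData, List.map_append, List.sum_append]
      simp only [List.map_cons, List.map_nil, List.sum_cons, List.sum_nil, add_zero,
        Move.completed, noiseWeight, logWeight, resid, add_sub_cancel_left]
      rw [Finset.sum_sub_distrib, Finset.mul_sum, Finset.sum_div]
      congr 2
      refine Finset.sum_congr rfl fun i _ => ?_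
      have h1 : √M.ρ ^ 2 = M.ρ := Real.sq_sqrt hρ.le
      rw [mul_pow, inv_pow, mul_pow, h1]
      field_simp

/-- The standard Gaussian measure. -/
def gaussMeasure (κ : Type*) [Fintype κ] : Measure (κ → ℝ) :=
  (gaussMass κ)⁻¹ • volume.withDensity fun x => ENNReal.ofReal (Real.exp (-(x ⬝ᵥ x) / 2))

lemma gaussMeasure_univ : gaussMeasure κ univ = 1 := by
  rw [gaussMeasure, Measure.smul_apply, withDensity_apply _ MeasurableSet.univ, setLIntegral_univ,
    smul_eq_mul]
  exact ENNReal.inv_mul_cancel gaussMass_ne_zero gaussMass_ne_top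

instance : IsProbabilityMeasure (gaussMeasure κ) := ⟨gaussMeasure_univ⟩

/-- Links the quantity computed from the stored data with the supermartingale: the Gaussian density
moves between the exponent and the measure. Iterations without measurement have weight zero and
change neither side. -/
lemma mixture_after (hρ : 0 < M.ρ) (hσ : 0 < M.σ) {Ω : Type*} (move : ℕ → Ω → Move P)
    (noise : ℕ → Ω → Fin (q + 1) → ℝ) (n : ℕ) (ω : Ω) :
    mixture M b (Memory.after M (fun j => move j ω) (fun j => noise j ω) n).data =
      mixProcess (gaussMeasure κ) M.σ (noiseWeight M b) (fun j ω => (move j ω).completed)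
        noise n ω := by
  have hm : Measurable fun x => ENNReal.ofReal (Real.exp
      (logProcess M.σ (noiseWeight M b) (fun j ω => (move j ω).completed) noise n ω x)) := by
    have h1 : ∀ o i, Measurable fun x => noiseWeight M b o x i := measurable_noiseWeight
    unfold logProcess
    fun_prop
  have hg : Measurable fun x : κ → ℝ => ENNReal.ofReal (Real.exp (-(x ⬝ᵥ x) / 2)) := by
    unfold dotProduct
    fun_prop
  rw [mixture, mixProcess, gaussMeasure, lintegral_smul_measure,
    lintegral_withDensity_eq_lintegral_mul _ hg hm, smul_eq_mul, mul_comm, div_eq_mul_inv]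
  congr 1
  refine lintegral_congr fun x => ?_
  rw [Pi.mul_apply, ← ENNReal.ofReal_mul (Real.exp_pos _).le, ← Real.exp_add,
    sum_logWeight_after hρ hσ]
  congr 2
  ring

end Mixture

/-! ### Counting the measurements of a run -/

lemma length_after (M : Model P) (move : ℕ → Move P) (noise : ℕ → Fin (q + 1) → ℝ) (n : ℕ) :
    (Memory.after M move noise n).data.length ≤ n := by
  induction n with
  | zero => simp [Memory.after, Memory.init]
  | succ n ih =>
    change (Memory.nextData _ (noise n) (move n)).length ≤ _
    cases move n with
    | idle => exact ih.trans (Nat.le_succ n)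
    | stopped p r => exact ih.trans (Nat.le_succ n)
    | done p => simpa [Memory.nextData] using ih

open Classical in
lemma visits_succ (move : ℕ → Move P) (n : ℕ) (p : P.Point) :
    Memory.visits move (n + 1) p =
      Memory.visits move n p + if move n = .done p then 1 else 0 := by
  have hfin : {j | j < n ∧ move j = .done p}.Finite :=
    (Set.finite_lt_nat n).subset fun j hj => hj.1
  unfold Memory.visits
  split_ifs with h
  · rw [← Set.ncard_insert_of_notMem (a := n) (by simp) hfin]
    congr 1
    ext j
    simp only [mem_ofPred_eq, mem_insert_iff]
    constructor
    · rintro ⟨h1, h2⟩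
      rcases Nat.lt_succ_iff_lt_or_eq.1 h1 with h3 | h3
      · exact Or.inr ⟨h3, h2⟩
      · exact Or.inl h3
    · rintro (rfl | ⟨h1, h2⟩)
      · exact ⟨Nat.lt_succ_self _, h⟩
      · exact ⟨by omega, h2⟩
  · rw [add_zero]
    congr 1
    ext j
    simp only [mem_ofPred_eq]
    refine ⟨fun ⟨h1, h2⟩ => ⟨lt_of_le_of_ne (Nat.lt_succ_iff.1 h1) ?_, h2⟩,
      fun ⟨h1, h2⟩ => ⟨by omega, h2⟩⟩
    rintro rfl
    exact h h2

open Classical in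
lemma card_eq_visits (M : Model P) (move : ℕ → Move P) (noise : ℕ → Fin (q + 1) → ℝ) (n : ℕ)
    (p : P.Point) :
    (Finset.univ.filter fun j : Fin (Memory.after M move noise n).data.length =>
      ((Memory.after M move noise n).data.get j).1 = p).card = Memory.visits move n p := by
  rw [Finset.card_filter,
    sum_get _ fun e : P.Datum => if e.1 = p then 1 else 0]
  induction n with
  | zero => simp [Memory.after, Memory.init, Memory.visits]
  | succ n ih =>
    rw [visits_succ, ← ih]
    change ((Memory.nextData _ (noise n) (move n)).map _).sum = _
    cases move n with
    | idle => simp [Memory.nextData]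
    | stopped p r => simp [Memory.nextData]
    | done p' => simp [Memory.nextData]

/-! ### From controlled noise to the corollary -/

/-- If the noise is under control along a run, the run finds an `ε`-optimal solution. -/
theorem eventually_optimal_of_noise (hP : P.Standing) {a : P.A} (ha : (a, P.x0) ∈ P.Rbar)
    {H : Type*} [NormedAddCommGroup H] [InnerProductSpace ℝ H] {M : Model P} {φ : P.Dom → H}
    (hk : ∀ u v, M.k u v = inner ℝ (φ u) (φ v)) {F : H}
    (hF : ∀ a x i, inner ℝ (φ (a, x, i)) F = P.h a x i) (hB : ‖F‖ ≤ M.B)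
    (hσ : 0 ≤ M.σ) (hρ : 1 / 8 ≤ M.ρ) (hδ : 0 < M.δ) (hδ1 : M.δ < 1)
    {move : ℕ → Move P} {noise : ℕ → Fin (q + 1) → ℝ} {guess : ℕ → P.A}
    (hL : ∀ n, (Memory.after M move noise n).Legal M (n + 1) (move n))
    (hguess : ∀ n, (Memory.after M move noise (n + 1)).IsBest (guess n))
    (hnoise : ∀ n (β : _ → ℝ),
      (M.gram (Model.loc (Memory.after M move noise n).data)).mulVec β + M.ρ • β =
        residVec (Memory.after M move noise n).data →
      (M.gram (Model.loc (Memory.after M move noise n).data)).mulVec β ⬝ᵥ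
        residVec (Memory.after M move noise n).data ≤
        2 * M.σ ^ 2 * (M.gamma (n * (q + 1)) + 1 + Real.log (1 / M.δ))) :
    ∃ N : ℕ, ∀ n ≥ N, P.Feasible (guess n) ∧ P.f a P.x0 - P.ε ≤ P.f (guess n) P.x0 := by
  classical
  have hρ0 : 0 < M.ρ := by linarith
  have hε := hP.ε_pos
  have : Nonempty P.Point := ⟨(a, P.x0)⟩
  obtain ⟨b, hb⟩ := exists_isFeature M hk
  have hBnn : 0 ≤ M.B := (norm_nonneg F).trans hB
  have hQ : ∀ n p i, P.h p.1 p.2 i ∈ M.Q (n + 1) (Memory.after M move noise n).data p i :=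
    fun n => mem_Q_of_noise_form_le hk hρ hσ hF hB
      (confidence_radicand_nonneg hb hρ0 hδ hδ1 _) (hnoise n)
  -- The threshold solves `2 * sqrtBeta (n + 1) * √(ρ / k) ≤ ε` for the number `k` of visits. The
  -- index is `n + 1` because the data after `n` iterations feed the intervals of the next one.
  refine Memory.eventually_optimal hP hQ hL
    (b := fun n => 4 * M.ρ / P.ε ^ 2 * M.sqrtBeta (n + 1) ^ 2) ?_ ?_ ?_ hguess ha
  · intro n n' h
    have h1 := sqrtBeta_mono hb hρ0 hσ (Nat.succ_le_succ h)
    have h2 := sqrtBeta_nonneg hBnn hσ (n + 1)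
    exact mul_le_mul_of_nonneg_left (pow_le_pow_left₀ h2 h1 2) (by positivity)
  · have hlim := (tendsto_sqrtBeta_sq_div hb hρ0 hδ hδ1).const_mul (4 * M.ρ / P.ε ^ 2)
    rw [mul_zero] at hlim
    exact hlim.congr fun n => (mul_div_assoc _ _ _).symm
  · intro n p i h1 hn
    refine (Memory.width_conf_le (Memory.valid_conf hP hQ n) p i).trans ?_
    set k := Memory.visits move n p
    have hk0 : (0 : ℝ) < k := by exact_mod_cast h1
    have hsB := sqrtBeta_nonneg hBnn hσ (n + 1)
    have hvar := var_le hk hρ0 (Memory.after M move noise n).data p i h1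
      (card_eq_visits M move noise n p)
    have hsd : M.sd (Memory.after M move noise n).data (P.toDom p i) ≤ √(M.ρ / k) :=
      Real.sqrt_le_sqrt hvar
    calc 2 * (M.sqrtBeta (n + 1) * M.sd (Memory.after M move noise n).data (P.toDom p i))
        ≤ 2 * (M.sqrtBeta (n + 1) * √(M.ρ / k)) := by gcongr
      _ ≤ P.ε := by
        refine abs_le_of_sq_le_sq' ?_ hε.le |>.2
        have h3 : √(M.ρ / k) ^ 2 = M.ρ / k := Real.sq_sqrt (by positivity)
        rw [mul_pow, mul_pow, h3]
        have h4 : 4 * M.ρ / P.ε ^ 2 * M.sqrtBeta (n + 1) ^ 2 * P.ε ^ 2 / k ≤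
            k * P.ε ^ 2 / k := by gcongr
        have h5 : (k : ℝ) * P.ε ^ 2 / k = P.ε ^ 2 := by field_simp
        have h6 : 4 * M.ρ / P.ε ^ 2 * M.sqrtBeta (n + 1) ^ 2 * P.ε ^ 2 / k =
            2 ^ 2 * (M.sqrtBeta (n + 1) ^ 2 * (M.ρ / k)) := by field_simp; ring
        linarith

lemma residVec_after_of_noise_eq_zero (M : Model P) (move : ℕ → Move P)
    {noise : ℕ → Fin (q + 1) → ℝ} (h : ∀ n i, noise n i = 0) (n : ℕ) :
    residVec (Memory.after M move noise n).data = 0 := by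
  have key : ∀ e ∈ (Memory.after M move noise n).data, ∀ i, resid e i = 0 := by
    induction n with
    | zero => simp [Memory.after, Memory.init]
    | succ n ih =>
      change ∀ e ∈ Memory.nextData _ (noise n) (move n), _
      cases move n with
      | idle => exact ih
      | stopped p r => exact ih
      | done p =>
        intro e he i
        rcases List.mem_append.1 he with he | he
        · exact ih e he i
        · rw [List.mem_singleton.1 he]
          simp [resid, h]
  ext j
  exact key _ (List.get_mem _ _) j.2

/-- With probability at least `1 - δ`, the noise is under control at all times. -/
lemma exists_event_noise (hP : P.Standing) {H : Type*} [NormedAddCommGroup H]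
    [InnerProductSpace ℝ H] {M : Model P} {φ : P.Dom → H}
    (hk : ∀ u v, M.k u v = inner ℝ (φ u) (φ v))
    (hσ : 0 ≤ M.σ) (hρ : 0 < M.ρ) (hδ : 0 < M.δ)
    {Ω : Type*} {mΩ : MeasurableSpace Ω} {ℙ : Measure Ω} [IsProbabilityMeasure ℙ]
    {ℱ : Filtration ℕ mΩ} {noise : ℕ → Ω → Fin (q + 1) → ℝ} {move : ℕ → Ω → Move P}
    (hv : SubGaussianNoise ℙ ℱ M.σ noise)
    (hmv : ∀ n mv, MeasurableSet[ℱ n] {ω | move n ω = mv}) :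
    ∃ E : Set Ω, MeasurableSet E ∧ ENNReal.ofReal (1 - M.δ) ≤ ℙ E ∧
      ∀ ω ∈ E, ∀ n (β : _ → ℝ),
        (M.gram (Model.loc (Memory.after M (fun j => move j ω)
          (fun j => noise j ω) n).data)).mulVec β + M.ρ • β =
          residVec (Memory.after M (fun j => move j ω) (fun j => noise j ω) n).data →
        (M.gram (Model.loc (Memory.after M (fun j => move j ω)
          (fun j => noise j ω) n).data)).mulVec β ⬝ᵥ
          residVec (Memory.after M (fun j => move j ω) (fun j => noise j ω) n).data ≤
          2 * M.σ ^ 2 * (M.gamma (n * (q + 1)) + 1 + Real.log (1 / M.δ)) := by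
  classical
  have : Nonempty P.Point := hP.seed_nominal.elim fun a _ => ⟨(a, P.x0)⟩
  obtain ⟨b, hb⟩ := exists_isFeature M hk
  -- The scale `(√ρ * σ)⁻¹` of the mixture degenerates at `σ = 0`. In that case the noise vanishes
  -- almost surely and so do all residuals.
  rcases hσ.eq_or_lt with hσ0 | hσ0
  · rw [← hσ0] at hv
    have hvm : ∀ n i, Measurable fun ω => noise n ω i := fun n i =>
      (hv.1 n i).mono (ℱ.le _) le_rfl
    have hE : MeasurableSet {ω | ∀ n i, noise n ω i = 0} := by
      have : {ω | ∀ n i, noise n ω i = 0} = ⋂ n, ⋂ i, {ω | noise n ω i = 0} := by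
        ext ω; simp
      rw [this]
      exact MeasurableSet.iInter fun n => MeasurableSet.iInter fun i =>
        measurableSet_eq_fun (hvm n i) measurable_const
    refine ⟨_, hE, ?_, fun ω hω n β _ => ?_⟩
    · rw [prob_compl_eq_zero_iff hE |>.1 (noise_ae_eq_zero hv), ← ENNReal.ofReal_one]
      exact ENNReal.ofReal_le_ofReal (by linarith)
    · rw [residVec_after_of_noise_eq_zero M _ hω, ← hσ0]
      simp
  · let _ : MeasurableSpace (Option P.Point) := ⊤
    have : DiscreteMeasurableSpace (Option P.Point) := ⟨fun _ => trivial⟩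
    have hsome : ∀ n p, MeasurableSet[ℱ n] {ω | (move n ω).completed = some p} := by
      intro n p
      have : {ω | (move n ω).completed = some p} = {ω | move n ω = .done p} := by
        ext ω
        simp only [mem_ofPred_eq]
        cases move n ω <;> simp [Move.completed]
      rw [this]
      exact hmv n _
    have hpt : ∀ n, Measurable[ℱ n] fun ω => (move n ω).completed := by
      intro n
      refine @measurable_to_countable' _ _ _ _ (ℱ n) _ fun o => ?_
      cases o with
      | some p => exact hsome n p
      | none =>
        have : (fun ω => (move n ω).completed) ⁻¹' {none} =
            (⋃ p, {ω | (move n ω).completed = some p})ᶜ := by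
          ext ω
          simp only [mem_preimage, mem_singleton_iff, mem_compl_iff, mem_iUnion, mem_ofPred_eq,
            not_exists]
          cases (move n ω).completed <;> simp
        rw [this]
        exact (MeasurableSet.iUnion fun p => hsome n p).compl
    set W := mixProcess (gaussMeasure (P.Point × Fin (q + 1))) M.σ (noiseWeight M b)
      (fun j ω => (move j ω).completed) noise with hW
    have hWm : ∀ n, Measurable (W n) := fun n =>
      (measurable_mixProcess (ℙ := ℙ) (ℱ := ℱ) measurable_noiseWeight hpt hv n).mono
        (ℱ.le n) le_rfl
    have hbad := measure_mixProcess_gt_le (ν := gaussMeasure (P.Point × Fin (q + 1)))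
      (c := noiseWeight M b) measurable_noiseWeight hpt gaussMeasure_univ.le hv hδ
    rw [← hW] at hbad
    have hbadm : MeasurableSet {ω | ∃ n, ENNReal.ofReal (1 / M.δ) < W n ω} := by
      have : {ω | ∃ n, ENNReal.ofReal (1 / M.δ) < W n ω} =
          ⋃ n, {ω | ENNReal.ofReal (1 / M.δ) < W n ω} := by ext ω; simp
      rw [this]
      exact MeasurableSet.iUnion fun n => measurableSet_lt measurable_const (hWm n)
    refine ⟨_, hbadm.compl, ?_, fun ω hω n β hβ => ?_⟩
    · rw [prob_compl_eq_one_sub hbadm, ENNReal.ofReal_sub _ hδ.le, ENNReal.ofReal_one]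
      exact tsub_le_tsub_left hbad 1
    · refine noise_form_le_of_mixture_le hb hρ hσ0 hδ ?_ (length_after M _ _ n) hβ
      rw [mixture_after hρ hσ0]
      by_contra hlt
      exact hω ⟨n, not_le.1 hlt⟩

end

end GoSafe

theorem corollary1 {d ℓ m q : ℕ} (P : GoSafe.Problem d ℓ m q) (hP : P.Standing)
    (aStar : P.A) (hStar : P.IsConstrainedMax aStar)
    (hAvoid : ∀ t : ℝ, 0 ≤ t → P.quant (P.traj aStar P.x0 t) ∉ P.border P.Rbar) :
    (aStar, P.x0) ∈ P.Rbar ∧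
    ∀ (H : Type*) [NormedAddCommGroup H] [InnerProductSpace ℝ H] [CompleteSpace H]
      [RKHS ℝ H P.Dom ℝ] (F : H) (M : GoSafe.Model P),
      (∀ (a : P.A) (x : P.X) (i : Fin (q + 1)), F (a, x, i) = P.h a x i) →
      ‖F‖ ≤ M.B →
      (∀ u v : P.Dom, M.k u v = RKHS.kernel H u v 1) →
      0 ≤ M.σ → 1 / 8 ≤ M.ρ → 0 < M.δ → M.δ < 1 →
      ∀ (Ω : Type*) (mΩ : MeasurableSpace Ω) (ℙ : MeasureTheory.Measure Ω)
        [MeasureTheory.IsProbabilityMeasure ℙ] (ℱ : MeasureTheory.Filtration ℕ mΩ)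
        (noise : ℕ → Ω → Fin (q + 1) → ℝ) (move : ℕ → Ω → GoSafe.Move P) (guess : ℕ → Ω → P.A),
        GoSafe.IsRun M ℙ ℱ noise move guess →
        ∃ E : Set Ω, MeasurableSet E ∧ ENNReal.ofReal (1 - M.δ) ≤ ℙ E ∧
          ∀ ω ∈ E, ∃ N : ℕ, ∀ n ≥ N,
            P.Feasible (guess n ω) ∧ P.f aStar P.x0 - P.ε ≤ P.f (guess n ω) P.x0 := by
  have hmem := hP.mem_Rbar_of_avoids (a := aStar) hAvoid
  refine ⟨hmem, ?_⟩
  intro H _ _ _ _ F M hF hB hk hσ hρ hδ hδ1 Ω mΩ ℙ _ ℱ noise move guess hrun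
  -- The kernel sections at `1` serve as feature map; the reproducing property then yields both the
  -- kernel and the values of `F` as inner products.
  have hk' : ∀ u v, M.k u v =
      inner ℝ (RKHS.kerFun H u (1 : ℝ)) (RKHS.kerFun H v (1 : ℝ)) := by
    intro u v
    have h := RKHS.kernel_inner (𝕜 := ℝ) H u v (1 : ℝ) (1 : ℝ)
    rw [hk, real_inner_comm, ← h]
    simp
  have hF' : ∀ a x i, inner ℝ (RKHS.kerFun H (a, x, i) (1 : ℝ)) F = P.h a x i := by
    intro a x i
    rw [RKHS.kerFun_inner, ← hF]
    simp
  obtain ⟨E, hE, hEp, hEn⟩ := GoSafe.exists_event_noise hP hk' hσ (by linarith) hδ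
    hrun.subGaussian hrun.predictable
  exact ⟨E, hE, hEp, fun ω hω => GoSafe.eventually_optimal_of_noise hP hmem hk' hF' hB hσ hρ hδ hδ1
    (fun n => hrun.legal n ω) (fun n => hrun.best n ω) (hEn ω hω)⟩
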